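/- **Theorem (Solid Harmonic Translation Theory).** For $n\in\mathbb{N}=\{0,1,2,\dots\}$ let $P_n(x)=\frac{1}{2^n n!}\frac{\mathrm{d}^n}{\mathrm{d}x^n}(x^2-1)^n$, and on $[-1,1]$ let $P_n^m(x)=(-1)^m(1-x^2)^{m/2}\frac{\mathrm{d}^m}{\mathrm{d}x^m}P_n(x)$ and $P_n^{-m}=(-1)^m\frac{(n-m)!}{(n+m)!}P_n^m$ for $0\le m\le n$. For $-n\le m\le n$ let $$Y_n^m(\theta,\phi)=\sqrt{\frac{2n+1}{4\pi}\frac{(n-m)!}{(n+m)!}}\,P_n^m(\cos\theta)\,e^{\imath m\phi},$$ and write $Y_n^m(\hat{\mathbf r})=Y_n^m(\theta,\phi)$ if $\mathbf r\in\mathbb{R}^3$ has spherical coordinates $(r,\theta,\phi)$, $r=|\mathbf r|$. Let $I_n^m(\mathbf r)=Y_n^m(\hat{\mathbf r})/r^{n+1}$ $(\mathbf r\ne 0)$ and $R_n^m(\mathbf r)=r^nY_n^m(\hat{\mathbf r})$ (with $R_0^0\equiv Y_0^0$ and $R_n^m(0)=0$ for $n\ge 1$) be the irregular and regular solid harmonics.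 Fix $n\in\mathbb{N}$. For $m\in\{-n,\dots,n\}$ and $\mathbf r,\mathrm{d}\mathbf r\in\mathbb{R}^3$ with $\mathbf r\neq 0$ put $\rho=\mathrm{d}r/r$, where $\mathrm{d}r=|\mathrm{d}\mathbf r|$, and $$t_\nu=2\sqrt{\pi}\sum_{\mu=-\nu}^{\nu}\frac{(-1)^{\nu+\mu}c_{\nu\mu}}{\sqrt{2\nu+1}}R_\nu^\mu(\mathrm{d}\mathbf r)\,I_{n+\nu}^{m-\mu}(\mathbf r),\qquad c_{\nu\mu}=\left(\frac{2n+1}{2n+2\nu+1}\binom{n+m+\nu-\mu}{\nu-\mu}\binom{n-m+\nu+\mu}{\nu+\mu}\right)^{1/2}.$$ 1. If $\rho<1$, then $$I_n^m(\mathbf r+\mathrm{d}\mathbf r)=\sum_{\nu=0}^{\infty}t_\nu ,$$ the series being absolutely convergent in $\nu$. For $p\in\mathbb{N}$ and $\rho<1$ let $\epsilon_p=\left|\sum_{\nu=p+1}^{\infty}t_\nu\right|$ be the truncation error. For $0<\delta\le 1$ let $N=N_\delta^{(n)}=(n+1)/\delta$, and for a real polynomial $q$ consider the bound $$\epsilon_p<\sqrt{\frac{3\,q(2N)}{4\pi\,(2n)!}}\;\frac{(1+\delta)^{p+1-N}\rho^{p+1}}{(1-\rho)\,r^{n+1}}\qquad\text{for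 all integers } p\ge N. \tag{$*$}$$ 2. There is a monic real polynomial $q$ of degree $2n+2$, depending only on $n$, such that $(*)$ holds for all $0<\delta\le 1$, all $m\in\{-n,\dots,n\}$ and all $\mathbf r\neq 0$, $\mathrm{d}\mathbf r\ne 0$ with $(1+\delta)\rho<1$. 3. For any $0<\delta\le 1$ and any $\rho_0<1$ there is a monic real polynomial $q$ of degree $2n+2$, depending only on $n$, $\delta$ and $\rho_0$, such that $(*)$ holds for all $m\in\{-n,\dots,n\}$ and all $\mathbf r\neq 0$, $\mathrm{d}\mathbf r\ne 0$ with $\rho\le\rho_0$. In particular, for all such $m,\mathbf r,\mathrm{d}\mathbf r$ with $\rho<1$ and every $0<\delta\le 1$ there is a monic $q$ of degree $2n+2$ for which $(*)$ holds. -/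

import Mathlib

open Polynomial

noncomputable section

/-- Points of three-dimensional Euclidean space. -/
abbrev Space3 : Type := EuclideanSpace ℝ (Fin 3)

/-- The Legendre polynomial `P_n`, by Rodrigues' formula
`P_n = (1 / (2 ^ n n!)) (d/dx)^n (x ^ 2 - 1) ^ n`. -/
def legendrePoly (n : ℕ) : ℝ[X] :=
  C (1 / (2 ^ n * (n.factorial : ℝ))) * derivative^[n] ((X ^ 2 - 1) ^ n)

/-- The associated Legendre function `P_n^k` on `[-1, 1]` for orders `k ≥ 0`:
`(-1)^k (1 - x ^ 2)^(k/2) (d/dx)^k P_n(x)`. -/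
def assocLegendreNonneg (n k : ℕ) (x : ℝ) : ℝ :=
  (-1) ^ k * Real.sqrt (1 - x ^ 2) ^ k * (derivative^[k] (legendrePoly n)).eval x

/-- The associated Legendre function `P_n^m` on `[-1, 1]` for orders `-n ≤ m ≤ n`; for `k ≥ 0`,
`P_n^{-k} = (-1)^k ((n - k)! / (n + k)!) P_n^k`. -/
def assocLegendre (n : ℕ) (m : ℤ) (x : ℝ) : ℝ :=
  if 0 ≤ m then assocLegendreNonneg n m.natAbs x
  else (-1) ^ m.natAbs * (((n - m.natAbs).factorial : ℝ) / ((n + m.natAbs).factorial : ℝ)) *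
    assocLegendreNonneg n m.natAbs x

/-- The spherical harmonic `Y_n^m(θ, φ)`, for `-n ≤ m ≤ n`. -/
def sphericalHarmonic (n : ℕ) (m : ℤ) (θ φ : ℝ) : ℂ :=
  (Real.sqrt ((2 * (n : ℝ) + 1) / (4 * Real.pi) *
      ((((n : ℤ) - m).toNat.factorial : ℝ) / (((n : ℤ) + m).toNat.factorial : ℝ))) : ℂ) *
    (assocLegendre n m (Real.cos θ) : ℂ) * Complex.exp (Complex.I * (m : ℂ) * (φ : ℂ))

/-- The polar angle `θ ∈ [0, π]` of a point. -/
def polarAngle (v : Space3) : ℝ := Real.arccos (v 2 / ‖v‖)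

/-- An azimuthal angle of a point. The value is taken in `(-π, π]`; since `Y_n^m(θ, φ)` is
`2π`-periodic in `φ`, this gives the same harmonics as the representative in `[0, 2π)`. -/
def azimuth (v : Space3) : ℝ := Complex.arg ⟨v 0, v 1⟩

/-- `Y_n^m(v̂)`, the spherical harmonic at the direction of `v`. -/
def sphericalHarmonicDir (n : ℕ) (m : ℤ) (v : Space3) : ℂ :=
  sphericalHarmonic n m (polarAngle v) (azimuth v)

/-- The irregular solid harmonic `I_n^m(v) = Y_n^m(v̂) / ‖v‖ ^ (n + 1)`. -/
def irregularSolid (n : ℕ) (m : ℤ) (v : Space3) : ℂ :=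
  sphericalHarmonicDir n m v / ((‖v‖ ^ (n + 1) : ℝ) : ℂ)

/-- The regular solid harmonic `R_n^m(v) = ‖v‖ ^ n Y_n^m(v̂)`. -/
def regularSolid (n : ℕ) (m : ℤ) (v : Space3) : ℂ :=
  ((‖v‖ ^ n : ℝ) : ℂ) * sphericalHarmonicDir n m v

/-- The coefficient `c_{νμ}` (for fixed `n`, `m` with `|m| ≤ n` and `|μ| ≤ ν`, so that all entries
of the binomial coefficients are nonnegative). -/
def translationCoeff (n : ℕ) (m : ℤ) (ν : ℕ) (μ : ℤ) : ℝ :=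
  Real.sqrt ((2 * (n : ℝ) + 1) / (2 * (n : ℝ) + 2 * (ν : ℝ) + 1) *
    (Nat.choose ((n : ℤ) + m + ν - μ).toNat ((ν : ℤ) - μ).toNat : ℝ) *
    (Nat.choose ((n : ℤ) - m + ν + μ).toNat ((ν : ℤ) + μ).toNat : ℝ))

/-- The `ν`-th term of the translation expansion, including the prefactor `2 √π`. -/
def translationTerm (n : ℕ) (m : ℤ) (r dr : Space3) (ν : ℕ) : ℂ :=
  ((2 * Real.sqrt Real.pi : ℝ) : ℂ) * ∑ μ ∈ Finset.Icc (-(ν : ℤ)) (ν : ℤ),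
    (-1 : ℂ) ^ ((ν : ℤ) + μ) * (translationCoeff n m ν μ : ℂ) /
        (Real.sqrt (2 * (ν : ℝ) + 1) : ℂ) *
      regularSolid ν μ dr * irregularSolid (n + ν) (m - μ) r

/-- The truncation error `ε_p`: the modulus of the tail `ν ≥ p + 1` of the expansion. -/
def truncationError (n : ℕ) (m : ℤ) (r dr : Space3) (p : ℕ) : ℝ :=
  ‖∑' k : ℕ, translationTerm n m r dr (p + 1 + k)‖

/-- The threshold `N_δ^{(n)} = (n + 1) / δ`. -/
def truncationThreshold (n : ℕ) (δ : ℝ) : ℝ := ((n : ℝ) + 1) / δ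

/-- The bound
`√(3 q(2N) / (4 π (2n)!)) (1 + δ)^(p + 1 - N) ρ^(p + 1) / ((1 - ρ) r^(n + 1))` with
`N = N_δ^{(n)}`, where `r` and `ρ` are real numbers. -/
def truncationBound (n : ℕ) (q : ℝ[X]) (δ ρ r : ℝ) (p : ℕ) : ℝ :=
  Real.sqrt (3 * q.eval (2 * truncationThreshold n δ) /
      (4 * Real.pi * ((2 * n).factorial : ℝ))) *
    ((1 + δ) ^ ((p : ℝ) + 1 - truncationThreshold n δ) * ρ ^ (p + 1) /
      ((1 - ρ) * r ^ (n + 1)))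

end

open scoped ComplexConjugate

noncomputable section

/-! The expansion is the Taylor series of `t ↦ I_n^m(r + t dr)` at `t = 0`, evaluated at `t = 1`.
After rescaling (`irrHarm`, `regHarm`), a directional derivative raises the degree of an irregular
harmonic by one and combines three neighbouring orders; regular harmonics obey a recurrence with the
same coefficients. Moving the derivative from one family to the other shows that the `ν`-th
derivative is `ν!` times the `ν`-th term (`irrHarm_line_iteratedDeriv`).

Along `r = dr` with `n = 0` the function is `1 / ((1 + t) r)`, so the same formula yields Unsöld's
theorem. With Cauchy–Schwarz this bounds the `ν`-th term by a constant times `(n + ν)^n ρ^ν /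
r^(n+1)`. The Taylor series thus converges beyond `t = 1`, and the identity theorem gives its sum.
`HasSum` in `ℂ` is unconditional, hence absolute, convergence.

Summing the tail bounds `ε_p` by a constant times `((p+1)^n + (1-ρ)^(-n)) ρ^(p+1) / ((1-ρ)
r^(n+1))`. For `p ≥ N` the power `(p+1)^n` costs at most a constant times `N^n (1+δ)^(p+1-N)`. Since
`q` need only be monic of degree `2n + 2`, a large coefficient of `X^(2n)` absorbs every constant.
-/

/-! ### Recurrences for Legendre polynomials and their derivatives -/

theorem legendrePoly_natDegree_le (n : ℕ) : (legendrePoly n).natDegree ≤ n := by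
  unfold legendrePoly
  refine (natDegree_C_mul_le _ _).trans ((natDegree_iterate_derivative _ _).trans ?_)
  have h : ((X ^ 2 - 1 : ℝ[X]) ^ n).natDegree ≤ n * 2 :=
    natDegree_pow_le_of_le n (by compute_degree)
  omega

theorem iterate_derivative_legendrePoly_eq_zero {n k : ℕ} (h : n < k) :
    derivative^[k] (legendrePoly n) = 0 :=
  iterate_derivative_eq_zero ((legendrePoly_natDegree_le n).trans_lt h)

/-- Leibniz' rule stops after three terms because one factor is quadratic. At `k = 0` the truncated
index `k - 1` is harmless: its coefficient vanishes. -/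
theorem iterate_derivative_X_sq_sub_one_mul (p : ℝ[X]) (k : ℕ) :
    derivative^[k + 1] ((X ^ 2 - 1) * p) = (X ^ 2 - 1) * derivative^[k + 1] p +
      2 * (k + 1 : ℝ[X]) * X * derivative^[k] p +
      (k + 1 : ℝ[X]) * (k : ℝ[X]) * derivative^[k - 1] p := by
  induction k with
  | zero => simp [derivative_mul]; ring
  | succ k ih =>
    rw [Function.iterate_succ_apply', ih]
    have e (j : ℕ) : derivative (derivative^[j] p) = derivative^[j + 1] p :=
      (Function.iterate_succ_apply' _ _ _).symm
    rcases k with _ | k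
    · simp [derivative_mul]; ring
    · simp only [derivative_add, derivative_mul, derivative_sub, derivative_X_sq, derivative_one,
        derivative_X, derivative_natCast, e, Nat.add_sub_cancel, derivative_ofNat, map_ofNat]
      push_cast
      ring

theorem iterate_derivative_X_mul' (p : ℝ[X]) (k : ℕ) :
    derivative^[k + 1] (X * p) =
      X * derivative^[k + 1] p + (k + 1 : ℝ[X]) * derivative^[k] p := by
  rw [mul_comm, iterate_derivative_mul_X]
  simp; ring

theorem derivative_X_sq_sub_one_pow_succ (n : ℕ) :
    derivative ((X ^ 2 - 1 : ℝ[X]) ^ (n + 1)) =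
      ((2 * (n + 1) : ℕ) : ℝ[X]) * (X * (X ^ 2 - 1) ^ n) := by
  rw [derivative_pow]; simp; ring

theorem legendrePoly_normalization (n : ℕ) :
    (C (1 / (2 ^ (n + 1) * ((n + 1).factorial : ℝ))) : ℝ[X]) * ((2 * (n + 1) : ℕ) : ℝ[X]) =
      C (1 / (2 ^ n * (n.factorial : ℝ))) := by
  rw [← C_eq_natCast, ← C_mul]
  congr 1
  rw [Nat.factorial_succ]; push_cast; field_simp; ring

/-- `P_{n+1}' = x P_n' + (n + 1) P_n`. -/
theorem derivative_legendrePoly_succ (n : ℕ) :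
    derivative (legendrePoly (n + 1)) =
      X * derivative (legendrePoly n) + (n + 1 : ℝ[X]) * legendrePoly n := by
  unfold legendrePoly
  simp only [derivative_C_mul, ← Function.iterate_succ_apply' derivative]
  rw [← legendrePoly_normalization n, Function.iterate_succ_apply,
    derivative_X_sq_sub_one_pow_succ, iterate_derivative_natCast_mul, iterate_derivative_X_mul']
  ring

/-- With `u = (x² - 1)^(n+1)`, differentiate `(x² - 1) u' = 2(n+1) x u` another `n + 1` times; the
terms in the `(n+1)`-st derivative cancel. -/
theorem X_sq_sub_one_mul_iterate_derivative (n : ℕ) :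
    (X ^ 2 - 1) * derivative^[n + 2] ((X ^ 2 - 1 : ℝ[X]) ^ (n + 1)) =
      (n + 1 : ℝ[X]) * (n + 2 : ℝ[X]) * derivative^[n] ((X ^ 2 - 1 : ℝ[X]) ^ (n + 1)) := by
  have h1 : (X ^ 2 - 1) * derivative ((X ^ 2 - 1 : ℝ[X]) ^ (n + 1)) =
      ((2 * (n + 1) : ℕ) : ℝ[X]) * (X * (X ^ 2 - 1) ^ (n + 1)) := by
    rw [derivative_X_sq_sub_one_pow_succ]; ring
  have h2 := congrArg (derivative^[n + 1]) h1
  rw [iterate_derivative_X_sq_sub_one_mul, iterate_derivative_natCast_mul,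
    iterate_derivative_X_mul'] at h2
  simp only [← Function.iterate_succ_apply derivative] at h2
  rcases n with _ | n
  · simp at h2 ⊢
    linear_combination h2
  · simp only [Nat.add_sub_cancel] at h2
    push_cast at h2 ⊢
    linear_combination h2

/-- `(1 - x²) P_n' = (n + 1) (x P_n - P_{n+1})`. -/
theorem one_sub_X_sq_mul_derivative_legendrePoly (n : ℕ) :
    (1 - X ^ 2) * derivative (legendrePoly n) =
      (n + 1 : ℝ[X]) * (X * legendrePoly n - legendrePoly (n + 1)) := by
  rcases n with _ | n
  · have h : (C (1 / 2) : ℝ[X]) * 2 = 1 := by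
      rw [← map_ofNat (C : ℝ →+* ℝ[X]) 2, ← C_mul]; norm_num
    simp only [legendrePoly]
    simp at h ⊢
    linear_combination X * h
  have h3 := X_sq_sub_one_mul_iterate_derivative n
  unfold legendrePoly
  simp only [derivative_C_mul, ← Function.iterate_succ_apply' derivative]
  rw [← legendrePoly_normalization (n + 1), Function.iterate_succ_apply derivative (n + 1)
      ((X ^ 2 - 1) ^ (n + 1 + 1)), derivative_X_sq_sub_one_pow_succ (n + 1),
    iterate_derivative_natCast_mul, iterate_derivative_X_mul']
  push_cast
  linear_combination (-(C (1 / (2 ^ (n + 1 + 1) * ((n + 1 + 1).factorial : ℝ))) : ℝ[X]) *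
    (2 * (n + 1 + 1 : ℝ[X]))) * h3

theorem iterate_derivative_legendrePoly_succ (n k : ℕ) :
    derivative^[k + 1] (legendrePoly (n + 1)) =
      X * derivative^[k + 1] (legendrePoly n) +
        (n + k + 1 : ℝ[X]) * derivative^[k] (legendrePoly n) := by
  induction k with
  | zero => simpa using derivative_legendrePoly_succ n
  | succ k ih =>
    have h := congrArg derivative ih
    simp only [derivative_add, derivative_mul, derivative_natCast, derivative_one, derivative_X,
      ← Function.iterate_succ_apply' derivative] at h
    push_cast
    linear_combination h

theorem one_sub_X_sq_mul_iterate_derivative_legendrePoly (n k : ℕ) :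
    (1 - X ^ 2) * derivative^[k + 1] (legendrePoly n) =
      (n + k + 1 : ℝ[X]) * X * derivative^[k] (legendrePoly n)
        - (n + 1 - k : ℝ[X]) * derivative^[k] (legendrePoly (n + 1)) := by
  induction k with
  | zero =>
    have h := one_sub_X_sq_mul_derivative_legendrePoly n
    simp
    linear_combination h
  | succ k ih =>
    have h := congrArg derivative ih
    simp only [derivative_add, derivative_sub, derivative_mul, derivative_natCast, derivative_one,
      derivative_X, derivative_X_sq, ← Function.iterate_succ_apply' derivative, map_ofNat] at h
    have h' := iterate_derivative_legendrePoly_succ n k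
    push_cast
    linear_combination h - h'

/-- The `k`-th derivative of the Legendre polynomial `P_n` at `x`. -/
def legendreDeriv (n k : ℕ) (x : ℝ) : ℝ := (derivative^[k] (legendrePoly n)).eval x

theorem legendreDeriv_eq_zero {n k : ℕ} (h : n < k) (x : ℝ) : legendreDeriv n k x = 0 := by
  rw [legendreDeriv, iterate_derivative_legendrePoly_eq_zero h, eval_zero]

theorem hasDerivAt_legendreDeriv (n k : ℕ) (x : ℝ) :
    HasDerivAt (legendreDeriv n k) (legendreDeriv n (k + 1) x) x := by
  unfold legendreDeriv
  rw [Function.iterate_succ_apply']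
  exact Polynomial.hasDerivAt _ x

theorem legendreDeriv_succ_succ (n k : ℕ) (x : ℝ) :
    legendreDeriv (n + 1) (k + 1) x =
      x * legendreDeriv n (k + 1) x + (n + k + 1 : ℝ) * legendreDeriv n k x := by
  simpa [legendreDeriv] using congrArg (eval x) (iterate_derivative_legendrePoly_succ n k)

theorem one_sub_sq_mul_legendreDeriv_succ (n k : ℕ) (x : ℝ) :
    (1 - x ^ 2) * legendreDeriv n (k + 1) x =
      (n + k + 1 : ℝ) * x * legendreDeriv n k x
        - (n + 1 - k : ℝ) * legendreDeriv (n + 1) k x := by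
  simpa [legendreDeriv] using
    congrArg (eval x) (one_sub_X_sq_mul_iterate_derivative_legendrePoly n k)

/-! ### Extension of ladder relations to negative orders -/

/-- The extension of a sequence `f` to negative orders by `f(-k) = (-1)^k conj (f k)`. -/
def signedExt (f : ℕ → ℂ) (m : ℤ) : ℂ :=
  if 0 ≤ m then f m.natAbs else (-1) ^ m.natAbs * conj (f m.natAbs)

@[simp] theorem signedExt_natCast (f : ℕ → ℂ) (k : ℕ) : signedExt f k = f k := by
  simp [signedExt]

theorem signedExt_neg_natCast {f : ℕ → ℂ} (h0 : conj (f 0) = f 0) (k : ℕ) :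
    signedExt f (-k) = (-1) ^ k * conj (f k) := by
  rcases k with _ | k
  · simp [signedExt, h0]
  · have : ¬ (0 : ℤ) ≤ -((k + 1 : ℕ) : ℤ) := by omega
    rw [signedExt, if_neg this]; simp only [Int.natAbs_neg, Int.natAbs_natCast]

theorem signedExt_neg {f : ℕ → ℂ} (h0 : conj (f 0) = f 0) (m : ℤ) :
    signedExt f (-m) = (-1) ^ m.natAbs * conj (signedExt f m) := by
  have hs (k : ℕ) : ((-1 : ℂ) ^ k) * (-1) ^ k = 1 := by rw [← mul_pow]; simp
  obtain ⟨k, rfl | rfl⟩ := m.eq_nat_or_neg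
  · rw [signedExt_neg_natCast h0]; simp
  · rw [signedExt_neg_natCast h0, neg_neg, signedExt_natCast]
    simp [← mul_assoc, hs]

/-- Conjugation carries the relation at order `k` to order `-k`. At order `0` the term of order `-1`
is `-conj (g 1)`, which explains the plus sign in `h0`. The cutoff `K` is needed because the
irregular relation is available only for orders up to the degree. -/
theorem signedExt_ladder {g D : ℕ → ℂ} {α : ℝ} {w : ℂ} {K : ℕ} (hg : conj (g 0) = g 0)
    (h0 : D 0 = α * g 0 + conj w / 2 * g 1 + w / 2 * conj (g 1))
    (hs : ∀ k, k + 1 ≤ K → D (k + 1) = α * g (k + 1) + conj w / 2 * g (k + 2) - w / 2 * g k)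
    (m : ℤ) (hm : m.natAbs ≤ K) :
    signedExt D m = α * signedExt g m + conj w / 2 * signedExt g (m + 1)
      - w / 2 * signedExt g (m - 1) := by
  have hD : conj (D 0) = D 0 := by
    rw [h0]
    simp only [map_add, map_mul, Complex.conj_ofReal, map_div₀, map_ofNat, Complex.conj_conj, hg]
    ring
  obtain ⟨k, rfl | rfl⟩ := m.eq_nat_or_neg
  · rcases k with _ | k
    · have e1 : signedExt g (((0 : ℕ) : ℤ) + 1) = g 1 := by simpa using signedExt_natCast g 1
      have e2 : signedExt g (((0 : ℕ) : ℤ) - 1) = (-1) ^ 1 * conj (g 1) := by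
        simpa using signedExt_neg_natCast hg 1
      rw [e1, e2, signedExt_natCast, signedExt_natCast, h0]; ring
    · have e1 : signedExt g (((k + 1 : ℕ) : ℤ) + 1) = g (k + 2) := signedExt_natCast g (k + 2)
      have e2 : signedExt g (((k + 1 : ℕ) : ℤ) - 1) = g k := by simp
      rw [e1, e2, signedExt_natCast, signedExt_natCast, hs k (by omega)]
  · rcases k with _ | k
    · have e1 : signedExt g (-((0 : ℕ) : ℤ) + 1) = g 1 := by simpa using signedExt_natCast g 1
      have e2 : signedExt g (-((0 : ℕ) : ℤ) - 1) = (-1) ^ 1 * conj (g 1) := by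
        simpa using signedExt_neg_natCast hg 1
      rw [e1, e2, signedExt_neg_natCast hD, signedExt_neg_natCast hg, hD, hg, h0]; ring
    · have e1 : signedExt g (-((k + 1 : ℕ) : ℤ) + 1) = (-1) ^ k * conj (g k) := by
        rw [← signedExt_neg_natCast hg]; congr 1; omega
      have e2 : signedExt g (-((k + 1 : ℕ) : ℤ) - 1) = (-1) ^ (k + 2) * conj (g (k + 2)) := by
        rw [← signedExt_neg_natCast hg]; congr 1
      rw [e1, e2, signedExt_neg_natCast hD, signedExt_neg_natCast hg,
        hs k (by omega)]
      simp only [map_sub, map_add, map_mul, Complex.conj_ofReal, map_div₀, map_ofNat,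
        Complex.conj_conj]
      ring

/-! ### Rescaled solid harmonics and the regular ladder -/

/-- The horizontal component `x + i y` of a point. -/
def planar (v : Space3) : ℂ := ⟨v 0, v 1⟩

theorem norm_sq_eq_planar (v : Space3) : ‖v‖ ^ 2 = ‖planar v‖ ^ 2 + v 2 ^ 2 := by
  rw [EuclideanSpace.real_norm_sq_eq, Fin.sum_univ_three, Complex.sq_norm, Complex.normSq_apply]
  simp [planar]; ring

theorem planar_mul_conj (v : Space3) : planar v * conj (planar v) = (‖v‖ : ℂ) ^ 2 - (v 2 : ℂ) ^ 2 := by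
  rw [Complex.mul_conj, Complex.normSq_eq_norm_sq]
  have := norm_sq_eq_planar v
  norm_cast
  linarith

/-- The function `P_n^k(cos θ) e^{ikφ}`, for `k ≥ 0`, in Cartesian form. -/
def surfaceHarm (n k : ℕ) (v : Space3) : ℂ :=
  (-1) ^ k * (planar v / ‖v‖) ^ k * legendreDeriv n k (v 2 / ‖v‖)

/-- The irregular solid harmonic `(n - k)! P_n^k(cos θ) e^{ikφ} / r ^ (n + 1)`, for `k ≥ 0`. -/
def irrNonneg (n k : ℕ) (v : Space3) : ℂ :=
  (n - k).factorial * surfaceHarm n k v / ‖v‖ ^ (n + 1)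

/-- The regular solid harmonic `r ^ n P_n^k(cos θ) e^{ikφ} / (n + k)!`, for `k ≥ 0`. -/
def regNonneg (n k : ℕ) (v : Space3) : ℂ :=
  ‖v‖ ^ n * surfaceHarm n k v / (n + k).factorial

/-- Irregular solid harmonics normalized so that all ladder coefficients are `±1`. -/
def irrHarm (n : ℕ) (m : ℤ) (v : Space3) : ℂ := signedExt (fun k => irrNonneg n k v) m

/-- Regular solid harmonics normalized so that all ladder coefficients are `±1`. -/
def regHarm (n : ℕ) (m : ℤ) (v : Space3) : ℂ := signedExt (fun k => regNonneg n k v) m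

theorem conj_irrNonneg_zero (n : ℕ) (v : Space3) : conj (irrNonneg n 0 v) = irrNonneg n 0 v := by
  simp [irrNonneg, surfaceHarm]

theorem conj_regNonneg_zero (n : ℕ) (v : Space3) : conj (regNonneg n 0 v) = regNonneg n 0 v := by
  simp [regNonneg, surfaceHarm]

theorem surfaceHarm_eq_zero {n k : ℕ} (h : n < k) (v : Space3) : surfaceHarm n k v = 0 := by
  simp [surfaceHarm, legendreDeriv_eq_zero h]

theorem regHarm_eq_zero {n : ℕ} {m : ℤ} (h : (n : ℤ) < |m|) (v : Space3) : regHarm n m v = 0 := by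
  have : n < m.natAbs := by rw [Int.abs_eq_natAbs] at h; omega
  simp [regHarm, signedExt, regNonneg, surfaceHarm_eq_zero this]

/-- The ladder relation for regular solid harmonics. -/
theorem regHarm_succ (n : ℕ) (m : ℤ) (v : Space3) :
    (n + 1 : ℂ) * regHarm (n + 1) m v = (v 2 : ℂ) * regHarm n m v
      + conj (planar v) / 2 * regHarm n (m + 1) v - planar v / 2 * regHarm n (m - 1) v := by
  have h : (n + 1 : ℂ) * regHarm (n + 1) m v =
      signedExt (fun k => (n + 1 : ℂ) * regNonneg (n + 1) k v) m := by
    unfold regHarm signedExt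
    split_ifs <;> simp
    ring
  rw [h]
  by_cases hv : v = 0
  · subst hv
    have : planar 0 = 0 := by apply Complex.ext <;> simp [planar]
    simp [this, signedExt, regNonneg]
  have hs : (‖v‖ : ℂ) ≠ 0 := by simpa using hv
  have hz : (v 2 : ℂ) = (v 2 / ‖v‖ : ℝ) * (‖v‖ : ℂ) := by push_cast; field_simp
  have hu : planar v / ‖v‖ * conj (planar v / ‖v‖) = 1 - ((v 2 / ‖v‖ : ℝ) : ℂ) ^ 2 := by
    have hW := planar_mul_conj v
    rw [map_div₀, Complex.conj_ofReal]; push_cast; field_simp; linear_combination hW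
  have hp : planar v = ‖v‖ * (planar v / ‖v‖) := by field_simp
  refine signedExt_ladder (K := m.natAbs) (conj_regNonneg_zero n v) ?_ ?_ m le_rfl
  · have hb := one_sub_sq_mul_legendreDeriv_succ n 0 (v 2 / ‖v‖)
    simp only [regNonneg, surfaceHarm]
    rw [hz, hp]
    simp only [mul_div_cancel_left₀ _ hs]
    generalize v 2 / ‖v‖ = c at *
    generalize planar v / ‖v‖ = u at *
    replace hb := congrArg (Complex.ofReal) hb
    push_cast at hb
    have hF : (n.factorial : ℂ) ≠ 0 := by exact_mod_cast n.factorial_ne_zero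
    have hn : (n + 1 : ℂ) ≠ 0 := by exact_mod_cast n.succ_ne_zero
    simp only [add_zero, Nat.factorial_succ, map_mul, map_div₀, Complex.conj_ofReal, map_pow,
      map_neg, map_one, map_natCast]
    push_cast
    field_simp
    linear_combination 2 * (‖v‖ : ℂ) ^ (n + 1) * ((legendreDeriv n 1 c : ℂ) * hu + hb)
  · intro k _
    have ha := legendreDeriv_succ_succ n k (v 2 / ‖v‖)
    have hb := one_sub_sq_mul_legendreDeriv_succ n (k + 1) (v 2 / ‖v‖)
    simp only [regNonneg, surfaceHarm]
    rw [hz, hp]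
    simp only [mul_div_cancel_left₀ _ hs]
    generalize v 2 / ‖v‖ = c at *
    generalize planar v / ‖v‖ = u at *
    replace ha := congrArg (Complex.ofReal) ha
    replace hb := congrArg (Complex.ofReal) hb
    push_cast at ha hb
    have hF : ((n + k).factorial : ℂ) ≠ 0 := by exact_mod_cast (n + k).factorial_ne_zero
    have h1 : (n + k + 1 : ℂ) ≠ 0 := by exact_mod_cast (n + k).succ_ne_zero
    have h2 : (n + k + 1 + 1 : ℂ) ≠ 0 := by exact_mod_cast (n + k + 1).succ_ne_zero
    rw [show n + 1 + (k + 1) = n + k + 1 + 1 by ring, show n + (k + 1) = n + k + 1 by ring,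
      show n + (k + 2) = n + k + 1 + 1 by ring]
    simp only [Nat.factorial_succ, map_mul, Complex.conj_ofReal]
    push_cast
    field_simp
    linear_combination (-1) ^ (k + 1) * u ^ (k + 1) * (‖v‖ : ℂ) ^ (n + 1) *
      ((legendreDeriv n (k + 2) c : ℂ) * hu + hb + (n + k + 2 : ℂ) * ha)

/-! ### Directional derivatives of irregular harmonics -/

theorem hasDerivAt_line_coord (r d : Space3) (i : Fin 3) (t : ℝ) :
    HasDerivAt (fun t : ℝ => (r + t • d) i) (d i) t := by
  simpa using ((hasDerivAt_id t).mul_const (d i)).const_add (r i)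

theorem planar_line (r d : Space3) (t : ℝ) : planar (r + t • d) = planar r + t * planar d := by
  apply Complex.ext <;> simp [planar]

theorem hasDerivAt_planar_line (r d : Space3) (t : ℝ) :
    HasDerivAt (fun t : ℝ => planar (r + t • d)) (planar d) t := by
  simp only [planar_line]
  simpa using ((hasDerivAt_id t).ofReal_comp.mul_const (planar d)).const_add (planar r)

theorem hasDerivAt_norm_line (r d : Space3) (t : ℝ) (h : r + t • d ≠ 0) :
    HasDerivAt (fun t : ℝ => ‖r + t • d‖)
      (((planar (r + t • d) * conj (planar d)).re + (r + t • d) 2 * d 2) / ‖r + t • d‖) t := by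
  have hn : ‖r + t • d‖ ≠ 0 := by simpa using h
  have e (v : Space3) : ‖v‖ = √(v 0 ^ 2 + v 1 ^ 2 + v 2 ^ 2) := by
    rw [EuclideanSpace.norm_eq, Fin.sum_univ_three]; simp
  have hc := fun i => hasDerivAt_line_coord r d i t
  have h0 : (r + t • d) 0 ^ 2 + (r + t • d) 1 ^ 2 + (r + t • d) 2 ^ 2 ≠ 0 := by
    intro h0; exact hn (by rw [e, h0, Real.sqrt_zero])
  have := ((((hc 0).fun_pow 2).fun_add ((hc 1).fun_pow 2)).fun_add ((hc 2).fun_pow 2)).sqrt h0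
  simp only [← e] at this
  refine this.congr_deriv ?_
  simp [planar]
  field_simp

/-- This is the part of an irregular harmonic left after removing the power of `x + iy`. The
vertical and horizontal components of `d` each meet exactly one Legendre recurrence:
`one_sub_sq_mul_legendreDeriv_succ` and `legendreDeriv_succ_succ`. -/
theorem hasDerivAt_legendreDeriv_div_norm_pow (n k : ℕ) (r d : Space3) (t : ℝ)
    (h : r + t • d ≠ 0) :
    HasDerivAt (fun t : ℝ => legendreDeriv n k ((r + t • d) 2 / ‖r + t • d‖) /
        ‖r + t • d‖ ^ (n + k + 1))
      (-((n + 1 - k : ℝ) * d 2 * (legendreDeriv (n + 1) k ((r + t • d) 2 / ‖r + t • d‖) /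
          ‖r + t • d‖ ^ (n + k + 2)))
        - (planar (r + t • d) * conj (planar d)).re *
          (legendreDeriv (n + 1) (k + 1) ((r + t • d) 2 / ‖r + t • d‖) /
          ‖r + t • d‖ ^ (n + k + 3))) t := by
  have hn : ‖r + t • d‖ ≠ 0 := by simpa using h
  have hs := hasDerivAt_norm_line r d t h
  have hz := hasDerivAt_line_coord r d 2 t
  have hc := hz.fun_div hs hn
  have hQ := (hasDerivAt_legendreDeriv n k _).comp t hc
  have := hQ.fun_div (hs.fun_pow (n + k + 1)) (pow_ne_zero _ hn)
  refine this.congr_deriv ?_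
  have ha := legendreDeriv_succ_succ n k ((r + t • d) 2 / ‖r + t • d‖)
  have hb := one_sub_sq_mul_legendreDeriv_succ n k ((r + t • d) 2 / ‖r + t • d‖)
  have hz' : (r + t • d) 2 = (r + t • d) 2 / ‖r + t • d‖ * ‖r + t • d‖ := by field_simp
  simp only [Function.comp_apply, Nat.add_sub_cancel]
  rw [ha]
  generalize (planar (r + t • d) * conj (planar d)).re = τ at *
  generalize hcdef : (r + t • d) 2 / ‖r + t • d‖ = c at *
  rw [hz']
  generalize ‖r + t • d‖ = s at *
  push_cast
  field_simp
  linear_combination s ^ (3 * n + 3 * k + 7) * d 2 * hb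

theorem hasDerivAt_irrNonneg_zero (n : ℕ) (r d : Space3) (t : ℝ) (h : r + t • d ≠ 0) :
    HasDerivAt (fun t : ℝ => irrNonneg n 0 (r + t • d))
      (((-d 2 : ℝ) : ℂ) * irrNonneg (n + 1) 0 (r + t • d)
        + conj (planar d) / 2 * irrNonneg (n + 1) 1 (r + t • d)
        + planar d / 2 * conj (irrNonneg (n + 1) 1 (r + t • d))) t := by
  have hn : (‖r + t • d‖ : ℂ) ≠ 0 := by simpa using h
  have hG := (hasDerivAt_legendreDeriv_div_norm_pow n 0 r d t h).ofReal_comp.const_mul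
    (n.factorial : ℂ)
  refine (hG.congr_deriv ?_).congr_of_eventuallyEq (.of_forall fun t => ?_)
  · simp only [irrNonneg, surfaceHarm]
    rw [Complex.ofReal_sub, Complex.ofReal_mul (Complex.re _), Complex.re_eq_add_conj]
    simp only [map_mul, map_div₀, Complex.conj_ofReal, map_pow, map_neg, map_one, map_natCast,
      Complex.conj_conj]
    simp only [Nat.sub_zero, Nat.add_sub_cancel, Nat.factorial_succ]
    push_cast
    field_simp
    ring
  · simp [irrNonneg, surfaceHarm]; ring

/-- Supplies the order-lowering coefficient: differentiating `(x + iy)^(k+1)` gives the first term,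
and the half of the real part containing `planar d` gives the second. -/
theorem two_mul_legendreDeriv_sub (n k : ℕ) (x : ℝ) :
    2 * (k + 1 : ℝ) * legendreDeriv n (k + 1) x - (1 - x ^ 2) * legendreDeriv (n + 1) (k + 2) x =
      (n + 1 - k : ℝ) * (n - k : ℝ) * legendreDeriv (n + 1) k x := by
  have ha := legendreDeriv_succ_succ n k x
  have ha' := legendreDeriv_succ_succ (n + 1) k x
  have hb := one_sub_sq_mul_legendreDeriv_succ n k x
  have hb' := one_sub_sq_mul_legendreDeriv_succ (n + 1) (k + 1) x
  push_cast at *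
  linear_combination -hb' + (n + 1 - k : ℝ) * ha' - 2 * (k + 1 : ℝ) * (x * ha - hb)

theorem irrNonneg_eq (n k : ℕ) (v : Space3) (hv : v ≠ 0) :
    irrNonneg n k v = (-1) ^ k * ((n - k).factorial : ℂ) * (planar v ^ k *
      ((legendreDeriv n k (v 2 / ‖v‖) / ‖v‖ ^ (n + k + 1) : ℝ) : ℂ)) := by
  have hn : (‖v‖ : ℂ) ≠ 0 := by simpa using hv
  rw [irrNonneg, surfaceHarm, div_pow, show n + k + 1 = k + (n + 1) by ring, pow_add]
  push_cast
  field_simp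
  ring

theorem eventually_line_ne_zero {r d : Space3} {t : ℝ} (h : r + t • d ≠ 0) :
    ∀ᶠ x : ℝ in nhds t, r + x • d ≠ 0 :=
  (by fun_prop : ContinuousAt (fun x : ℝ => r + x • d) t).eventually_ne h

theorem hasDerivAt_irrNonneg_succ (n k : ℕ) (hk : k + 1 ≤ n) (r d : Space3) (t : ℝ)
    (h : r + t • d ≠ 0) :
    HasDerivAt (fun t : ℝ => irrNonneg n (k + 1) (r + t • d))
      (((-d 2 : ℝ) : ℂ) * irrNonneg (n + 1) (k + 1) (r + t • d)
        + conj (planar d) / 2 * irrNonneg (n + 1) (k + 2) (r + t • d)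
        - planar d / 2 * irrNonneg (n + 1) k (r + t • d)) t := by
  have hn : (‖r + t • d‖ : ℂ) ≠ 0 := by simpa using h
  obtain ⟨j, rfl⟩ := Nat.exists_eq_add_of_le hk
  have hG := (((hasDerivAt_planar_line r d t).fun_pow (k + 1)).fun_mul
    (hasDerivAt_legendreDeriv_div_norm_pow (k + 1 + j) (k + 1) r d t h).ofReal_comp).const_mul
    ((-1) ^ (k + 1) * (j.factorial : ℂ))
  refine (hG.congr_deriv ?_).congr_of_eventuallyEq
    ((eventually_line_ne_zero h).mono fun x hx => ?_)
  · have hu : planar (r + t • d) * conj (planar (r + t • d)) =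
        ‖r + t • d‖ ^ 2 * (1 - (((r + t • d) 2 / ‖r + t • d‖ : ℝ) : ℂ) ^ 2) := by
      rw [planar_mul_conj]; push_cast; field_simp
    have hq := congrArg Complex.ofReal
      (two_mul_legendreDeriv_sub (k + 1 + j) k ((r + t • d) 2 / ‖r + t • d‖))
    simp only [irrNonneg_eq _ _ _ h]
    rw [Complex.ofReal_sub, Complex.ofReal_mul (Complex.re _), Complex.re_eq_add_conj]
    simp only [map_mul, Complex.conj_conj, Nat.add_sub_cancel]
    rw [show k + 1 + j + 1 - (k + 1) = j + 1 by omega, show k + 1 + j + 1 - (k + 2) = j by omega,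
      show k + 1 + j + 1 - k = j + 1 + 1 by omega,
      show k + 1 + j + 1 + (k + 1) + 1 = k + 1 + j + (k + 1) + 1 + 1 by ring,
      show k + 1 + j + 1 + (k + 2) + 1 = k + 1 + j + (k + 1) + 1 + 2 by ring,
      show k + 1 + j + 1 + k + 1 = k + 1 + j + (k + 1) + 1 by ring]
    simp only [show k + 1 + j + (k + 1) + 2 = k + 1 + j + (k + 1) + 1 + 1 by ring,
      show k + 1 + j + (k + 1) + 3 = k + 1 + j + (k + 1) + 1 + 2 by ring]
    clear hG
    generalize (r + t • d) 2 / ‖r + t • d‖ = c at *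
    generalize k + 1 + j + (k + 1) + 1 = M
    simp only [Nat.factorial_succ, pow_add ‖r + t • d‖ M]
    push_cast at hq ⊢
    have hS : (‖r + t • d‖ : ℂ) ^ M ≠ 0 := pow_ne_zero _ hn
    generalize (‖r + t • d‖ : ℂ) ^ M = S at *
    generalize planar (r + t • d) = W at *
    field_simp
    linear_combination ((j.factorial : ℂ) * (-1) ^ (k + 1) * W ^ k * planar d) *
      (‖r + t • d‖ ^ 2 * hq - (legendreDeriv (k + 1 + j + 1) (k + 2) c : ℂ) * hu)
  · beta_reduce
    rw [irrNonneg_eq _ _ _ hx, show k + 1 + j - (k + 1) = j by omega]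

/-- The ladder relation for directional derivatives of irregular solid harmonics. -/
theorem irrHarm_line_hasDerivAt (n : ℕ) (m : ℤ) (hm : |m| ≤ (n : ℤ)) (r d : Space3) (t : ℝ)
    (h : r + t • d ≠ 0) :
    HasDerivAt (fun t : ℝ => irrHarm n m (r + t • d))
      (((-d 2 : ℝ) : ℂ) * irrHarm (n + 1) m (r + t • d)
        + conj (planar d) / 2 * irrHarm (n + 1) (m + 1) (r + t • d)
        - planar d / 2 * irrHarm (n + 1) (m - 1) (r + t • d)) t := by
  have hm' : m.natAbs ≤ n := by rw [Int.abs_eq_natAbs] at hm; omega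
  let D : ℕ → ℂ := fun k => deriv (fun t : ℝ => irrNonneg n k (r + t • d)) t
  have hD (k : ℕ) (hk : k ≤ n) :
      HasDerivAt (fun t : ℝ => irrNonneg n k (r + t • d)) (D k) t := by
    rcases k with _ | k
    · exact (hasDerivAt_irrNonneg_zero n r d t h).differentiableAt.hasDerivAt
    · exact (hasDerivAt_irrNonneg_succ n k hk r d t h).differentiableAt.hasDerivAt
  have key := signedExt_ladder (g := fun k => irrNonneg (n + 1) k (r + t • d)) (D := D)
    (conj_irrNonneg_zero (n + 1) _) (hasDerivAt_irrNonneg_zero n r d t h).deriv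
    (fun k hk => (hasDerivAt_irrNonneg_succ n k hk r d t h).deriv) m hm'
  unfold irrHarm
  rw [← key]
  unfold signedExt
  split_ifs
  · exact hD _ hm'
  · exact (hD _ hm').star.const_mul _

/-! ### Taylor coefficients along a line -/

/-- Since `a` vanishes beyond `ν`, both sides are sums over all of `ℤ`, so the shift leaves no
boundary terms. -/
theorem sum_Icc_shift {a g : ℤ → ℂ} {ν : ℕ} (ha : ∀ μ : ℤ, (ν : ℤ) < |μ| → a μ = 0) (e : ℤ)
    (he : |e| ≤ 1) :
    ∑ μ ∈ Finset.Icc (-(ν : ℤ)) ν, a μ * g (μ - e) =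
      ∑ μ ∈ Finset.Icc (-((ν + 1 : ℕ) : ℤ)) (ν + 1 : ℕ), a (μ + e) * g μ := by
  rw [← finsum_eq_sum_of_support_subset (fun μ => a μ * g (μ - e)),
    ← finsum_eq_sum_of_support_subset (fun μ => a (μ + e) * g μ),
    ← finsum_comp_equiv (Equiv.addRight e)]
  · simp
  · intro μ hμ
    have h1 : a (μ + e) ≠ 0 := fun h => hμ (by simp [h])
    have h2 : |μ + e| ≤ ν := by by_contra h; exact h1 (ha _ (by omega))
    rw [abs_le] at h2 he
    simp only [Finset.coe_Icc, Set.mem_Icc]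
    push_cast
    omega
  · intro μ hμ
    have h1 : a μ ≠ 0 := fun h => hμ (by simp [h])
    have h2 : |μ| ≤ ν := by by_contra h; exact h1 (ha _ (by omega))
    simpa [abs_le] using h2

/-- The coefficients of the expansion of translated irregular solid harmonics. -/
def shiftCoeff (d : Space3) (ν : ℕ) (μ : ℤ) : ℂ := (-1 : ℂ) ^ ((ν : ℤ) + μ) * regHarm ν μ d

theorem shiftCoeff_eq_zero (d : Space3) {ν : ℕ} {μ : ℤ} (h : (ν : ℤ) < |μ|) :
    shiftCoeff d ν μ = 0 := by simp [shiftCoeff, regHarm_eq_zero h]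

theorem shiftCoeff_succ (d : Space3) (ν : ℕ) (μ : ℤ) :
    (ν + 1 : ℂ) * shiftCoeff d (ν + 1) μ = ((-d 2 : ℝ) : ℂ) * shiftCoeff d ν μ
      + conj (planar d) / 2 * shiftCoeff d ν (μ + 1)
      - planar d / 2 * shiftCoeff d ν (μ - 1) := by
  have h := regHarm_succ ν μ d
  have h1 : (-1 : ℂ) ≠ 0 := by norm_num
  have e1 : (-1 : ℂ) ^ (((ν + 1 : ℕ) : ℤ) + μ) = -(-1 : ℂ) ^ ((ν : ℤ) + μ) := by
    rw [show ((ν + 1 : ℕ) : ℤ) + μ = (ν + μ) + 1 by push_cast; ring, zpow_add_one₀ h1]; ring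
  have e2 : (-1 : ℂ) ^ ((ν : ℤ) + (μ + 1)) = -(-1 : ℂ) ^ ((ν : ℤ) + μ) := by
    rw [← add_assoc, zpow_add_one₀ h1]; ring
  have e3 : (-1 : ℂ) ^ ((ν : ℤ) + (μ - 1)) = -(-1 : ℂ) ^ ((ν : ℤ) + μ) := by
    rw [← add_sub_assoc, zpow_sub_one₀ h1]; norm_num
  unfold shiftCoeff
  rw [e1, e2, e3]
  push_cast
  linear_combination (-(-1 : ℂ) ^ ((ν : ℤ) + μ)) * h

/-- The `ν`-th term of the translation expansion for the harmonics `irrHarm`. -/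
def shiftTerm (n : ℕ) (m : ℤ) (d : Space3) (ν : ℕ) (v : Space3) : ℂ :=
  ∑ μ ∈ Finset.Icc (-(ν : ℤ)) ν, shiftCoeff d ν μ * irrHarm (n + ν) (m - μ) v

/-- Summation by parts in `μ`: the irregular ladder acts on the harmonics, and reindexing transfers
it to the coefficients, where `shiftCoeff_succ` recognizes the next degree. -/
theorem shiftTerm_line_hasDerivAt (n : ℕ) (m : ℤ) (hm : |m| ≤ (n : ℤ)) (r d : Space3) (ν : ℕ)
    (t : ℝ) (h : r + t • d ≠ 0) :
    HasDerivAt (fun t : ℝ => shiftTerm n m d ν (r + t • d))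
      ((ν + 1 : ℂ) * shiftTerm n m d (ν + 1) (r + t • d)) t := by
  have hd : HasDerivAt (fun t : ℝ => shiftTerm n m d ν (r + t • d)) _ t :=
    HasDerivAt.fun_sum (u := Finset.Icc (-(ν : ℤ)) ν) fun μ hμ =>
      (irrHarm_line_hasDerivAt (n + ν) (m - μ) (by
        rw [Finset.mem_Icc] at hμ; rw [abs_le] at hm ⊢; push_cast; omega) r d t h).const_mul
        (shiftCoeff d ν μ)
  refine hd.congr_deriv ?_
  have hz (e : ℤ) (he : |e| ≤ 1) := sum_Icc_shift (a := shiftCoeff d ν)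
    (g := fun μ => irrHarm (n + ν + 1) (m - μ) (r + t • d))
    (fun μ hμ => shiftCoeff_eq_zero d hμ) e he
  have hz0 := hz 0 (by simp)
  have hz1 := hz 1 (by simp)
  have hz2 := hz (-1) (by simp)
  simp only [sub_zero, add_zero, sub_neg_eq_add] at hz0 hz1 hz2
  have e1 (μ : ℤ) : m - μ + 1 = m - (μ - 1) := by ring
  have e2 (μ : ℤ) : m - μ - 1 = m - (μ + 1) := by ring
  have : (ν + 1 : ℂ) * shiftTerm n m d (ν + 1) (r + t • d) =
      ∑ μ ∈ Finset.Icc (-((ν + 1 : ℕ) : ℤ)) (ν + 1 : ℕ),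
        ((ν + 1 : ℂ) * shiftCoeff d (ν + 1) μ) * irrHarm (n + ν + 1) (m - μ) (r + t • d) := by
    rw [shiftTerm, Finset.mul_sum]; simp only [mul_assoc, add_assoc]
  rw [this]
  simp only [shiftCoeff_succ]
  simp only [e1, e2, add_mul, sub_mul, mul_add, mul_sub, Finset.sum_add_distrib,
    Finset.sum_sub_distrib, mul_assoc, mul_left_comm (shiftCoeff d ν _), ← Finset.mul_sum,
    hz0, hz1, hz2, ← sub_eq_add_neg]

theorem irrHarm_line_iteratedDeriv (n : ℕ) (m : ℤ) (hm : |m| ≤ (n : ℤ)) (r d : Space3) (ν : ℕ)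
    (t : ℝ) (h : r + t • d ≠ 0) :
    iteratedDeriv ν (fun t : ℝ => irrHarm n m (r + t • d)) t =
      (ν.factorial : ℂ) * shiftTerm n m d ν (r + t • d) := by
  induction ν generalizing t with
  | zero =>
    have : regHarm 0 0 d = 1 := by
      simp [regHarm, signedExt, regNonneg, surfaceHarm, legendreDeriv, legendrePoly]
    simp [shiftTerm, shiftCoeff, this]
  | succ ν ih =>
    rw [iteratedDeriv_succ, Filter.EventuallyEq.deriv_eq
      ((eventually_line_ne_zero h).mono fun x hx => ih x hx),
      ((shiftTerm_line_hasDerivAt n m hm r d ν t h).const_mul _).deriv, Nat.factorial_succ]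
    push_cast
    ring

/-! ### Unsöld's theorem and the bound on each term -/

/-- The product `(n - m)! (n + m)!`. -/
def factProd (n : ℕ) (m : ℤ) : ℝ :=
  ((n : ℤ) - m).toNat.factorial * ((n : ℤ) + m).toNat.factorial

theorem factProd_pos (n : ℕ) (m : ℤ) : 0 < factProd n m := by unfold factProd; positivity

theorem factProd_eq (n : ℕ) (m : ℤ) :
    factProd n m = (n - m.natAbs).factorial * (n + m.natAbs).factorial := by
  obtain ⟨k, rfl | rfl⟩ := m.eq_nat_or_neg
  · have e1 : ((n : ℤ) - k).toNat = n - k := by omega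
    have e2 : ((n : ℤ) + k).toNat = n + k := by omega
    simp [factProd, e1, e2]
  · have e1 : ((n : ℤ) - -k).toNat = n + k := by omega
    have e2 : ((n : ℤ) + -k).toNat = n - k := by omega
    simp only [factProd, e1, e2, Int.natAbs_neg, Int.natAbs_natCast, mul_comm]

theorem irrHarm_eq_regHarm (n : ℕ) (m : ℤ) (v : Space3) (hv : v ≠ 0) :
    irrHarm n m v = factProd n m * regHarm n m v / ‖v‖ ^ (2 * n + 1) := by
  have hn : (‖v‖ : ℂ) ≠ 0 := by simpa using hv
  have h (k : ℕ) : irrNonneg n k v =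
      ((n - k).factorial * (n + k).factorial : ℝ) * regNonneg n k v / ‖v‖ ^ (2 * n + 1) := by
    have hF : ((n + k).factorial : ℂ) ≠ 0 := by exact_mod_cast (n + k).factorial_ne_zero
    rw [irrNonneg, regNonneg, show 2 * n + 1 = n + (n + 1) by ring, pow_add]
    push_cast
    field_simp
    ring
  rw [factProd_eq, irrHarm, regHarm]
  unfold signedExt
  split_ifs
  · exact h _
  · simp only [h, map_mul, map_div₀, map_pow, Complex.conj_ofReal]
    ring

theorem irrHarm_neg (n : ℕ) (m : ℤ) (v : Space3) :
    irrHarm n (-m) v = (-1) ^ m.natAbs * conj (irrHarm n m v) :=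
  signedExt_neg (conj_irrNonneg_zero n v) m

theorem iteratedDeriv_one_add_inv_mul (c : ℝ) (ν : ℕ) (t : ℝ) (ht : 1 + t ≠ 0) :
    iteratedDeriv ν (fun t : ℝ => (((1 + t)⁻¹ * c : ℝ) : ℂ)) t =
      (((-1) ^ ν * ν.factorial * ((1 + t) ^ (ν + 1))⁻¹ * c : ℝ) : ℂ) := by
  induction ν generalizing t with
  | zero => simp
  | succ ν ih =>
    have hev : ∀ᶠ x : ℝ in nhds t, 1 + x ≠ 0 :=
      (by fun_prop : ContinuousAt (fun x : ℝ => 1 + x) t).eventually_ne ht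
    rw [iteratedDeriv_succ, Filter.EventuallyEq.deriv_eq (hev.mono fun x hx => ih x hx)]
    have h1 : HasDerivAt (fun x : ℝ => 1 + x) 1 t := (hasDerivAt_id t).const_add 1
    have h2 := (((h1.fun_pow (ν + 1)).fun_inv (pow_ne_zero _ ht)).const_mul
      ((-1) ^ ν * (ν.factorial : ℝ))).mul_const c
    rw [h2.ofReal_comp.deriv]
    congr 1
    rw [Nat.factorial_succ]
    push_cast
    field_simp
    ring

/-- Here the base point and the direction coincide, so the function on the line is `1 / ((1 + t)
‖v‖)`, with explicit derivatives to compare with the general formula. -/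
theorem shiftTerm_self (v : Space3) (hv : v ≠ 0) (ν : ℕ) :
    shiftTerm 0 0 v ν v = (-1) ^ ν / ‖v‖ := by
  have hn : ‖v‖ ≠ 0 := by simpa using hv
  have h := irrHarm_line_iteratedDeriv 0 0 (by simp) v v ν 0 (by simpa)
  have hF : (ν.factorial : ℂ) ≠ 0 := by exact_mod_cast ν.factorial_ne_zero
  have he : (fun t : ℝ => irrHarm 0 0 (v + t • v)) =ᶠ[nhds 0]
      fun t : ℝ => (((1 + t)⁻¹ * ‖v‖⁻¹ : ℝ) : ℂ) := by
    filter_upwards [lt_mem_nhds (show (-1 : ℝ) < 0 by norm_num)] with t ht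
    have : ‖v + t • v‖ = (1 + t) * ‖v‖ := by
      rw [show v + t • v = (1 + t) • v by rw [add_smul, one_smul], norm_smul, Real.norm_eq_abs,
        abs_of_pos (by linarith)]
    simp [irrHarm, signedExt, irrNonneg, surfaceHarm, legendreDeriv, legendrePoly, this]
    ring
  rw [he.iteratedDeriv_eq, iteratedDeriv_one_add_inv_mul _ _ 0 (by simp)] at h
  simp only [zero_smul, add_zero] at h
  apply mul_left_cancel₀ hF
  rw [← h]
  simp
  ring

/-- Unsöld's theorem. -/
theorem sum_factProd_mul_norm_regHarm_sq (ν : ℕ) (v : Space3) (hv : v ≠ 0) :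
    ∑ μ ∈ Finset.Icc (-(ν : ℤ)) ν, factProd ν μ * ‖regHarm ν μ v‖ ^ 2 = ‖v‖ ^ (2 * ν) := by
  have hn : ‖v‖ ≠ 0 := by simpa using hv
  have hn' : (‖v‖ : ℂ) ≠ 0 := by simpa using hv
  have h := shiftTerm_self v hv ν
  -- The order `-μ` brings in a conjugate, and irregular is a multiple of regular, so every summand
  -- becomes a squared modulus with the same sign `(-1)^ν`.
  have e (μ : ℤ) : shiftCoeff v ν μ * irrHarm (0 + ν) (0 - μ) v =
      (-1) ^ ν / (‖v‖ : ℂ) ^ (2 * ν + 1) * ((factProd ν μ * ‖regHarm ν μ v‖ ^ 2 : ℝ) : ℂ) := by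
    have hc : regHarm ν μ v * conj (regHarm ν μ v) = ((‖regHarm ν μ v‖ ^ 2 : ℝ) : ℂ) := by
      rw [Complex.mul_conj, Complex.normSq_eq_norm_sq]
    have hz : (-1 : ℂ) ^ ((ν : ℤ) + μ) * (-1) ^ μ.natAbs = (-1) ^ ν := by
      rw [zpow_add₀ (by norm_num), zpow_natCast, mul_assoc]
      obtain ⟨k, rfl | rfl⟩ := μ.eq_nat_or_neg
      · simp [← mul_pow]
      · simp [← mul_pow, ← inv_pow]
    rw [zero_add, zero_sub, irrHarm_neg, irrHarm_eq_regHarm _ _ _ hv, shiftCoeff, ← hz,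
      Complex.ofReal_mul, ← hc]
    simp only [map_mul, map_div₀, map_pow, Complex.conj_ofReal]
    ring
  rw [shiftTerm] at h
  simp only [e, ← Finset.mul_sum, ← Complex.ofReal_sum] at h
  rw [div_mul_eq_mul_div, div_eq_div_iff (pow_ne_zero _ hn') hn', mul_assoc, mul_right_inj'
    (pow_ne_zero _ (by norm_num)), pow_succ, mul_left_inj' hn'] at h
  exact_mod_cast h

/-- The two factorials gain `n - m` and `n + m` factors, together `2n`, each at most `2n + 2ν`. -/
theorem factProd_add_sub_le (n ν : ℕ) (m : ℤ) (hm : |m| ≤ (n : ℤ)) (μ : ℤ) (hμ : |μ| ≤ (ν : ℤ)) :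
    factProd (n + ν) (m - μ) ≤ (2 * n + 2 * ν : ℝ) ^ (2 * n) * factProd ν μ := by
  have hf (a k : ℕ) (h : a + k ≤ 2 * n + 2 * ν) :
      (((a + k).factorial : ℕ) : ℝ) ≤ (2 * n + 2 * ν : ℝ) ^ k * a.factorial := by
    have : (a + k).factorial ≤ (2 * n + 2 * ν) ^ k * a.factorial := by
      rw [← Nat.factorial_mul_ascFactorial, mul_comm]
      gcongr
      exact (Nat.ascFactorial_le_pow_add a k).trans (Nat.pow_le_pow_left h k)
    exact_mod_cast this
  rw [abs_le] at hm hμ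
  have h1 := hf ((ν : ℤ) + μ).toNat ((n : ℤ) - m).toNat (by omega)
  have h2 := hf ((ν : ℤ) - μ).toNat ((n : ℤ) + m).toNat (by omega)
  have e1 : (((n + ν : ℕ) : ℤ) - (m - μ)).toNat = ((ν : ℤ) + μ).toNat + ((n : ℤ) - m).toNat := by
    omega
  have e2 : (((n + ν : ℕ) : ℤ) + (m - μ)).toNat = ((ν : ℤ) - μ).toNat + ((n : ℤ) + m).toNat := by
    omega
  have e3 : 2 * n = ((n : ℤ) - m).toNat + ((n : ℤ) + m).toNat := by omega
  unfold factProd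
  rw [e1, e2, e3, pow_add]
  calc _ ≤ _ := mul_le_mul h1 h2 (by positivity) (by positivity)
    _ = _ := by ring

theorem sum_norm_regHarm_sq_le (ν : ℕ) (v : Space3) :
    ∑ μ ∈ Finset.Icc (-(ν : ℤ)) ν, factProd ν μ * ‖regHarm ν μ v‖ ^ 2 ≤ ‖v‖ ^ (2 * ν) := by
  by_cases hv : v = 0
  · subst hv
    rcases ν with _ | ν
    · simp [factProd, regHarm, signedExt, regNonneg, surfaceHarm, legendreDeriv, legendrePoly]
    · simp [regHarm, signedExt, regNonneg]
  · exact (sum_factProd_mul_norm_regHarm_sq ν v hv).le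

/-- Cauchy–Schwarz with weights `√(factProd ν μ)`. Unsöld in degree `ν` handles the regular factor;
Unsöld in degree `n + ν` handles the irregular one, at the price of the ratio in
`factProd_add_sub_le`. -/
theorem norm_shiftTerm_le (n : ℕ) (m : ℤ) (hm : |m| ≤ (n : ℤ)) (r d : Space3) (hr : r ≠ 0)
    (ν : ℕ) :
    ‖shiftTerm n m d ν r‖ ≤ (2 * n + 2 * ν : ℝ) ^ n * ‖d‖ ^ ν / ‖r‖ ^ (n + ν + 1) := by
  have hn : 0 < ‖r‖ := by simpa using hr
  have hm' := abs_le.1 hm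
  have hfac (μ : ℤ) : 0 < √(factProd ν μ) := Real.sqrt_pos.2 (factProd_pos ν μ)
  have h1 : ‖shiftTerm n m d ν r‖ ≤ ∑ μ ∈ Finset.Icc (-(ν : ℤ)) ν,
      (√(factProd ν μ) * ‖regHarm ν μ d‖) *
        (‖irrHarm (n + ν) (m - μ) r‖ / √(factProd ν μ)) := by
    refine (norm_sum_le _ _).trans (Finset.sum_le_sum fun μ _ => ?_)
    rw [shiftCoeff, norm_mul, norm_mul, norm_zpow, norm_neg, norm_one, one_zpow, one_mul]
    have := (hfac μ).ne'
    field_simp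
    rfl
  have h2 := Finset.sum_mul_sq_le_sq_mul_sq (Finset.Icc (-(ν : ℤ)) ν)
    (fun μ => √(factProd ν μ) * ‖regHarm ν μ d‖)
    (fun μ => ‖irrHarm (n + ν) (m - μ) r‖ / √(factProd ν μ))
  have h3 : ∑ μ ∈ Finset.Icc (-(ν : ℤ)) ν, (√(factProd ν μ) * ‖regHarm ν μ d‖) ^ 2 ≤
      ‖d‖ ^ (2 * ν) := by
    simp only [mul_pow, Real.sq_sqrt (factProd_pos ν _).le]
    exact sum_norm_regHarm_sq_le ν d
  set C : ℝ := (2 * n + 2 * ν : ℝ) ^ (2 * n) / ‖r‖ ^ (2 * (2 * (n + ν) + 1)) with hC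
  have hCnn : 0 ≤ C := by positivity
  have h4 : ∑ μ ∈ Finset.Icc (-(ν : ℤ)) ν,
      (‖irrHarm (n + ν) (m - μ) r‖ / √(factProd ν μ)) ^ 2 ≤ C * ‖r‖ ^ (2 * (n + ν)) := by
    rw [← sum_factProd_mul_norm_regHarm_sq (n + ν) r hr, Finset.mul_sum]
    calc _ ≤ ∑ μ ∈ Finset.Icc (-(ν : ℤ)) ν,
          C * (factProd (n + ν) (m - μ) * ‖regHarm (n + ν) (m - μ) r‖ ^ 2) := by
          refine Finset.sum_le_sum fun μ hμ => ?_
          have hle := factProd_add_sub_le n ν m hm μ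
            (by rw [Finset.mem_Icc] at hμ; exact abs_le.2 hμ)
          have hp := factProd_pos ν μ
          have hp' := factProd_pos (n + ν) (m - μ)
          rw [irrHarm_eq_regHarm _ _ _ hr, div_pow, Real.sq_sqrt hp.le, norm_div, norm_mul,
            norm_pow, Complex.norm_real, Complex.norm_real, norm_norm, Real.norm_of_nonneg hp'.le,
            div_pow, mul_pow, ← pow_mul, hC, mul_comm (2 * (n + ν) + 1) 2, div_div,
            div_mul_eq_mul_div, div_le_div_iff₀ (by positivity) (by positivity)]
          have := mul_le_mul_of_nonneg_right hle (show 0 ≤ factProd (n + ν) (m - μ) *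
            ‖regHarm (n + ν) (m - μ) r‖ ^ 2 * ‖r‖ ^ (2 * (2 * (n + ν) + 1)) by positivity)
          linarith
      -- The orders `m - μ` are distinct and lie in `[-(n+ν), n+ν]`, so this is part of a full
      -- Unsöld sum.
      _ = ∑ μ ∈ (Finset.Icc (-(ν : ℤ)) ν).image (fun μ => m - μ),
          C * (factProd (n + ν) μ * ‖regHarm (n + ν) μ r‖ ^ 2) :=
          by rw [Finset.sum_image]; intro a _ b _ h; simpa using h
      _ ≤ _ := by
          refine Finset.sum_le_sum_of_subset_of_nonneg ?_ fun μ _ _ => ?_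
          · intro μ hμ
            simp only [Finset.mem_image, Finset.mem_Icc] at hμ ⊢
            obtain ⟨a, ha, rfl⟩ := hμ
            push_cast
            omega
          · have := factProd_pos (n + ν) μ
            positivity
  refine h1.trans (abs_le_of_sq_le_sq' ?_ (by positivity)).2
  refine h2.trans ((mul_le_mul h3 h4 (Finset.sum_nonneg fun _ _ => sq_nonneg _)
    (by positivity)).trans (le_of_eq ?_))
  rw [hC]
  field_simp
  ring

/-! ### Convergence of the Taylor series -/

theorem eventually_hasSum_of_iteratedDeriv {f : ℝ → ℂ} (hf : AnalyticAt ℝ f 0) {c : ℕ → ℂ}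
    (hc : ∀ ν, iteratedDeriv ν f 0 = (ν.factorial : ℂ) * c ν) :
    ∀ᶠ t : ℝ in nhds 0, HasSum (fun ν => c ν * (t : ℂ) ^ ν) (f t) := by
  obtain ⟨p, R, hp⟩ := hf
  have hcoeff (ν : ℕ) : p.coeff ν = c ν := by
    have h := hp.factorial_smul 1 ν
    rw [← iteratedDeriv_eq_iteratedFDeriv, hc] at h
    have hF : (ν.factorial : ℂ) ≠ 0 := by exact_mod_cast ν.factorial_ne_zero
    rw [nsmul_eq_mul] at h
    exact mul_left_cancel₀ hF h
  filter_upwards [hp.hasFPowerSeriesAt.eventually_hasSum] with t ht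
  simpa [FormalMultilinearSeries.apply_eq_pow_smul_coeff, hcoeff, mul_comm] using ht

/-- Real analyticity alone gives the expansion only near `0`. Summability at `R` makes the series
holomorphic on the complex disc, and the identity theorem on the real interval extends the equality.
-/
theorem hasSum_of_iteratedDeriv {f : ℝ → ℂ} {R : ℝ}
    (hf : ∀ t : ℝ, |t| < R → AnalyticAt ℝ f t) {c : ℕ → ℂ}
    (hc : ∀ ν, iteratedDeriv ν f 0 = (ν.factorial : ℂ) * c ν)
    (hs : Summable fun ν => ‖c ν‖ * R ^ ν) {t : ℝ} (ht : |t| < R) :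
    HasSum (fun ν => c ν * (t : ℂ) ^ ν) (f t) := by
  have hR : 0 < R := (abs_nonneg t).trans_lt ht
  have hbound (ν : ℕ) (z : ℂ) (hz : z ∈ Metric.ball (0 : ℂ) R) :
      ‖c ν * z ^ ν‖ ≤ ‖c ν‖ * R ^ ν := by
    rw [norm_mul, norm_pow]
    have : ‖z‖ ≤ R := by simpa using (mem_ball_zero_iff.1 hz).le
    gcongr
  have hG : DifferentiableOn ℂ (fun z => ∑' ν, c ν * z ^ ν) (Metric.ball 0 R) :=
    Complex.differentiableOn_tsum_of_summable_norm hs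
      (fun ν => by fun_prop) Metric.isOpen_ball hbound
  have hGa := hG.analyticOnNhd Metric.isOpen_ball
  have hmem (x : ℝ) (hx : x ∈ Metric.ball (0 : ℝ) R) : (x : ℂ) ∈ Metric.ball (0 : ℂ) R := by
    simpa using hx
  have hg : AnalyticOnNhd ℝ (fun x : ℝ => ∑' ν, c ν * (x : ℂ) ^ ν) (Metric.ball 0 R) := fun x hx =>
    ((hGa _ (hmem x hx)).restrictScalars (𝕜 := ℝ)).comp (Complex.ofRealCLM.analyticAt x)
  have hfa : AnalyticOnNhd ℝ f (Metric.ball 0 R) := fun x hx => hf x (by simpa using hx)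
  have heq := hfa.eqOn_of_preconnected_of_eventuallyEq hg
    (convex_ball (0 : ℝ) R).isPreconnected (Metric.mem_ball_self hR)
    ((eventually_hasSum_of_iteratedDeriv (hf 0 (by simpa using hR)) hc).mono
      fun x hx => hx.tsum_eq.symm)
  have htm : t ∈ Metric.ball (0 : ℝ) R := by simpa using ht
  rw [heq htm]
  exact (Summable.of_norm_bounded hs fun ν => hbound ν _ (hmem t htm)).hasSum

theorem analyticAt_irrHarm_line (n : ℕ) (m : ℤ) (r d : Space3) (t : ℝ) (h : r + t • d ≠ 0) :
    AnalyticAt ℝ (fun t : ℝ => irrHarm n m (r + t • d)) t := by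
  have hn : (‖r + t • d‖ : ℂ) ≠ 0 := by simpa using h
  have hn' : ‖r + t • d‖ ≠ 0 := by simpa using h
  have ho (g : ℝ → ℝ) (hg : AnalyticAt ℝ g t) : AnalyticAt ℝ (fun t => (g t : ℂ)) t :=
    (Complex.ofRealCLM.analyticAt _).comp hg
  have hnorm : AnalyticAt ℝ (fun t : ℝ => ‖r + t • d‖) t :=
    ((contDiffAt_norm ℝ h).comp t (f := fun t : ℝ => r + t • d) (by fun_prop)).analyticAt
  have hz : AnalyticAt ℝ (fun t : ℝ => (r + t • d) 2) t := by
    simp; fun_prop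
  have hp : AnalyticAt ℝ (fun t : ℝ => planar (r + t • d)) t := by
    simp only [planar_line]
    exact analyticAt_const.add ((ho _ analyticAt_id).mul analyticAt_const)
  have hk (k : ℕ) : AnalyticAt ℝ (fun t : ℝ => irrNonneg n k (r + t • d)) t := by
    have hQ : AnalyticAt ℝ (fun t : ℝ => legendreDeriv n k ((r + t • d) 2 / ‖r + t • d‖)) t := by
      unfold legendreDeriv
      exact AnalyticAt.aeval_polynomial (hz.fun_div hnorm hn') _
    unfold irrNonneg surfaceHarm
    exact (analyticAt_const.fun_mul ((analyticAt_const.fun_mul ((hp.fun_div (ho _ hnorm) hn).fun_pow k)).fun_mul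
      (ho _ hQ))).fun_div ((ho _ hnorm).fun_pow _) (pow_ne_zero _ hn)
  unfold irrHarm signedExt
  split_ifs
  · exact hk _
  · exact analyticAt_const.fun_mul ((Complex.conjCLE.toContinuousLinearMap.analyticAt _).comp (hk _))

theorem hasSum_shiftTerm (n : ℕ) (m : ℤ) (hm : |m| ≤ (n : ℤ)) (r d : Space3) (hr : r ≠ 0)
    (hd : ‖d‖ / ‖r‖ < 1) :
    HasSum (fun ν => shiftTerm n m d ν r) (irrHarm n m (r + d)) := by
  have hn : 0 < ‖r‖ := by simpa using hr
  set ρ := ‖d‖ / ‖r‖ with hρ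
  have hρ0 : 0 ≤ ρ := by positivity
  -- Chosen so that `1 < R` and `R ρ < 1`: the point `t = 1` is interior, and the line misses the
  -- origin for `|t| < R`.
  set R := 2 / (1 + ρ) with hR
  have hR1 : 1 < R := by rw [hR, lt_div_iff₀ (by linarith)]; linarith
  have hRρ : R * ρ < 1 := by
    rw [hR, div_mul_eq_mul_div, div_lt_one (by linarith)]; linarith
  have hne (t : ℝ) (ht : |t| < R) : r + t • d ≠ 0 := by
    intro h0
    have h1 : ‖r‖ = |t| * ‖d‖ := by
      rw [eq_neg_of_add_eq_zero_left h0, norm_neg, norm_smul, Real.norm_eq_abs]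
    have h2 : |t| * ρ = 1 := by rw [hρ, ← mul_div_assoc, ← h1, div_self hn.ne']
    have h3 : |t| * ρ ≤ R * ρ := by gcongr
    linarith
  have key := hasSum_of_iteratedDeriv (f := fun t : ℝ => irrHarm n m (r + t • d)) (R := R)
    (c := fun ν => shiftTerm n m d ν r) (t := 1)
    (fun t ht => analyticAt_irrHarm_line n m r d t (hne t ht))
    (fun ν => by simpa using irrHarm_line_iteratedDeriv n m hm r d ν 0 (by simpa using hr))
    ?_ (by simpa using hR1)
  · simpa using key
  have hs : Summable fun ν : ℕ => (ν : ℝ) ^ n * (R * ρ) ^ ν :=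
    summable_pow_mul_geometric_of_norm_lt_one n
      (by rw [Real.norm_of_nonneg (by positivity)]; exact hRρ)
  have hg := summable_geometric_of_lt_one (show 0 ≤ R * ρ by positivity) hRρ
  refine Summable.of_nonneg_of_le (fun ν => by positivity) (fun ν => ?_)
    (((hs.mul_left (2 ^ n)).add (hg.mul_left ((2 * n : ℝ) ^ n))).mul_left (2 ^ n / ‖r‖ ^ (n + 1)))
  have h1 : (2 * n + 2 * ν : ℝ) ^ n ≤ 2 ^ n * ((2 * n : ℝ) ^ n + (2 * ν : ℝ) ^ n) := by
    refine (add_pow_le (by positivity) (by positivity) n).trans ?_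
    gcongr
    · norm_num
    · omega
  calc _ ≤ ((2 * n + 2 * ν : ℝ) ^ n * ‖d‖ ^ ν / ‖r‖ ^ (n + ν + 1)) * R ^ ν := by
        gcongr; exact norm_shiftTerm_le n m hm r d hr ν
    _ = (2 * n + 2 * ν : ℝ) ^ n * ((R * ρ) ^ ν / ‖r‖ ^ (n + 1)) := by
        have hdr : ‖d‖ = ρ * ‖r‖ := by rw [hρ]; field_simp
        rw [hdr, mul_pow, mul_pow, show n + ν + 1 = ν + (n + 1) by ring, pow_add ‖r‖]
        field_simp
    _ ≤ 2 ^ n * ((2 * n : ℝ) ^ n + (2 * ν : ℝ) ^ n) * ((R * ρ) ^ ν / ‖r‖ ^ (n + 1)) := by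
        gcongr
    _ = _ := by rw [mul_pow 2 (ν : ℝ)]; ring

/-! ### Return to the spherical normalization -/

theorem abs_coord_two_div_norm_le (v : Space3) : |v 2 / ‖v‖| ≤ 1 := by
  rw [abs_div, abs_norm]
  exact div_le_one_of_le₀ (by simpa using PiLp.norm_apply_le v 2) (norm_nonneg v)

theorem cos_polarAngle (v : Space3) : Real.cos (polarAngle v) = v 2 / ‖v‖ := by
  have h := abs_le.1 (abs_coord_two_div_norm_le v)
  exact Real.cos_arccos h.1 h.2

theorem planar_div_norm_eq (v : Space3) (hv : v ≠ 0) :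
    planar v / ‖v‖ = (√(1 - (v 2 / ‖v‖) ^ 2) : ℂ) * Complex.exp (Complex.I * azimuth v) := by
  have hn : ‖v‖ ≠ 0 := by simpa using hv
  have h : √(1 - (v 2 / ‖v‖) ^ 2) = ‖planar v‖ / ‖v‖ := by
    have h2 : 1 - (v 2 / ‖v‖) ^ 2 = (‖planar v‖ / ‖v‖) ^ 2 := by
      have := norm_sq_eq_planar v
      field_simp
      linarith
    rw [h2, Real.sqrt_sq (by positivity)]
  have hp := Complex.norm_mul_exp_arg_mul_I (planar v)
  rw [h, mul_comm Complex.I, azimuth]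
  push_cast
  rw [div_mul_eq_mul_div]
  exact congrArg (· / (‖v‖ : ℂ)) hp.symm

theorem surfaceHarm_eq (n k : ℕ) (v : Space3) (hv : v ≠ 0 ∨ k = 0) :
    surfaceHarm n k v = assocLegendreNonneg n k (Real.cos (polarAngle v)) *
      Complex.exp (Complex.I * k * azimuth v) := by
  rw [cos_polarAngle, surfaceHarm, assocLegendreNonneg]
  rcases hv with hv | rfl
  · rw [planar_div_norm_eq v hv, mul_pow, ← Complex.exp_nat_mul]
    rw [show (k : ℂ) * (Complex.I * azimuth v) = Complex.I * k * azimuth v by ring, legendreDeriv]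
    push_cast
    ring
  · simp [legendreDeriv]

theorem irrNonneg_assoc (n k : ℕ) (v : Space3) (hv : v ≠ 0) :
    irrNonneg n k v = (n - k).factorial * (assocLegendreNonneg n k (Real.cos (polarAngle v)) *
      Complex.exp (Complex.I * k * azimuth v)) / ‖v‖ ^ (n + 1) := by
  rw [irrNonneg, surfaceHarm_eq n k v (.inl hv)]

/-- The factor `(n - m)!` clears the factorial quotient in `P_n^{-k}`, leaving just the sign and
conjugation of `signedExt`. -/
theorem assocLegendre_signed (n : ℕ) (m : ℤ) (hm : |m| ≤ (n : ℤ)) (x φ : ℝ) :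
    ((((n : ℤ) - m).toNat.factorial : ℝ) : ℂ) *
      ((assocLegendre n m x : ℂ) * Complex.exp (Complex.I * m * φ)) =
    signedExt (fun k => ((n - k).factorial : ℂ) *
      ((assocLegendreNonneg n k x : ℂ) * Complex.exp (Complex.I * k * φ))) m := by
  unfold signedExt assocLegendre
  obtain ⟨k, rfl | rfl⟩ := m.eq_nat_or_neg
  · have e1 : ((n : ℤ) - k).toNat = n - k := by omega
    simp [e1]
  · have e1 : ((n : ℤ) - -k).toNat = n + k := by omega
    rcases k with _ | k
    · simp
    have h0 : ¬ (0 : ℤ) ≤ -((k + 1 : ℕ) : ℤ) := by omega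
    have hF : ((n + (k + 1)).factorial : ℂ) ≠ 0 := by
      exact_mod_cast (n + (k + 1)).factorial_ne_zero
    rw [if_neg h0, if_neg h0, e1]
    simp only [Int.natAbs_neg, Int.natAbs_natCast, map_mul, Complex.conj_ofReal, map_natCast,
      ← Complex.exp_conj, Complex.conj_I]
    push_cast
    rw [show Complex.I * -((k : ℂ) + 1) * φ = -Complex.I * (k + 1) * φ by ring]
    field_simp

theorem irrHarm_eq_assocLegendre (n : ℕ) (m : ℤ) (hm : |m| ≤ (n : ℤ)) (v : Space3) (hv : v ≠ 0) :
    irrHarm n m v = ((((n : ℤ) - m).toNat.factorial : ℝ) : ℂ) *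
      ((assocLegendre n m (Real.cos (polarAngle v)) : ℂ) *
        Complex.exp (Complex.I * m * azimuth v)) / ‖v‖ ^ (n + 1) := by
  rw [assocLegendre_signed n m hm, irrHarm]
  unfold signedExt
  split_ifs
  · exact irrNonneg_assoc n _ v hv
  · simp only [irrNonneg_assoc n _ v hv, map_mul, map_div₀, map_pow, Complex.conj_ofReal]
    ring

/-- The factor between `irrHarm` and `irregularSolid`. -/
def irrNormalization (n : ℕ) (m : ℤ) : ℝ := √((2 * n + 1) / (4 * Real.pi) / factProd n m)

theorem irregularSolid_eq (n : ℕ) (m : ℤ) (hm : |m| ≤ (n : ℤ)) (v : Space3) (hv : v ≠ 0) :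
    irregularSolid n m v = irrNormalization n m * irrHarm n m v := by
  have hF : 0 < (((n : ℤ) - m).toNat.factorial : ℝ) := by positivity
  have hs : √((2 * (n : ℝ) + 1) / (4 * Real.pi) *
      ((((n : ℤ) - m).toNat.factorial : ℝ) / (((n : ℤ) + m).toNat.factorial : ℝ))) =
      irrNormalization n m * ((n : ℤ) - m).toNat.factorial := by
    rw [irrNormalization, ← Real.sqrt_sq hF.le, ← Real.sqrt_mul (by unfold factProd; positivity),
      Real.sqrt_sq hF.le]
    congr 1
    unfold factProd
    field_simp
  rw [irregularSolid, sphericalHarmonicDir, sphericalHarmonic, hs,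
    irrHarm_eq_assocLegendre n m hm v hv]
  push_cast
  ring

theorem regularSolid_eq (n : ℕ) (m : ℤ) (hm : |m| ≤ (n : ℤ)) (v : Space3) :
    regularSolid n m v = √((2 * n + 1) / (4 * Real.pi) * factProd n m) * regHarm n m v := by
  by_cases hv : v = 0
  · subst hv
    rcases n with _ | n
    · obtain rfl : m = 0 := by simpa using hm
      simp [regularSolid, sphericalHarmonicDir, sphericalHarmonic, assocLegendre,
        assocLegendreNonneg, regHarm, signedExt, regNonneg, surfaceHarm, legendreDeriv,
        legendrePoly, factProd]
    · simp [regularSolid, regHarm, signedExt, regNonneg]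
  have hn : (‖v‖ : ℂ) ≠ 0 := by simpa using hv
  have hr : regularSolid n m v = irregularSolid n m v * ‖v‖ ^ (2 * n + 1) := by
    rw [regularSolid, irregularSolid, show 2 * n + 1 = n + (n + 1) by ring, pow_add]
    push_cast
    field_simp
    ring
  have hs : √((2 * n + 1) / (4 * Real.pi) * factProd n m) = irrNormalization n m * factProd n m := by
    have hp := factProd_pos n m
    rw [irrNormalization, ← Real.sqrt_sq hp.le, ← Real.sqrt_mul (by positivity),
      Real.sqrt_sq hp.le]
    congr 1
    field_simp
  rw [hr, irregularSolid_eq n m hm v hv, irrHarm_eq_regHarm n m v hv, hs]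
  push_cast
  field_simp

/-- The two binomials multiply to `factProd (n + ν) (m - μ) / (factProd ν μ * factProd n m)`, so all
dependence on `ν` and `μ` cancels. -/
theorem translationCoeff_normalization (n : ℕ) (m : ℤ) (hm : |m| ≤ (n : ℤ)) (ν : ℕ) (μ : ℤ)
    (hμ : |μ| ≤ (ν : ℤ)) :
    2 * √Real.pi * (translationCoeff n m ν μ / √(2 * (ν : ℝ) + 1) *
      √((2 * ν + 1) / (4 * Real.pi) * factProd ν μ) * irrNormalization (n + ν) (m - μ)) =
    irrNormalization n m := by
  rw [abs_le] at hm hμ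
  have hc (a b : ℕ) : ((a + b).choose a : ℝ) = (a + b).factorial / (a.factorial * b.factorial) := by
    rw [Nat.cast_add_choose]
  have h2 : (2 : ℝ) * √Real.pi = √(4 * Real.pi) := by
    rw [show (4 : ℝ) = 2 ^ 2 by norm_num, Real.sqrt_mul (by positivity), Real.sqrt_sq (by norm_num)]
  have e1 : ((n : ℤ) + m + ν - μ).toNat = ((ν : ℤ) - μ).toNat + ((n : ℤ) + m).toNat := by omega
  have e2 : ((n : ℤ) - m + ν + μ).toNat = ((ν : ℤ) + μ).toNat + ((n : ℤ) - m).toNat := by omega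
  have e3 : (((n + ν : ℕ) : ℤ) - (m - μ)).toNat = ((ν : ℤ) + μ).toNat + ((n : ℤ) - m).toNat := by
    omega
  have e4 : (((n + ν : ℕ) : ℤ) + (m - μ)).toNat = ((ν : ℤ) - μ).toNat + ((n : ℤ) + m).toNat := by
    omega
  have hp := Real.pi_pos
  unfold translationCoeff irrNormalization factProd
  rw [e1, e2, e3, e4, hc, hc, h2, ← Real.sqrt_div' _ (by positivity),
    ← Real.sqrt_mul (by positivity), ← Real.sqrt_mul (by positivity),
    ← Real.sqrt_mul (by positivity)]
  congr 1
  push_cast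
  field_simp

theorem translationTerm_eq (n : ℕ) (m : ℤ) (hm : |m| ≤ (n : ℤ)) (r d : Space3) (hr : r ≠ 0)
    (ν : ℕ) : translationTerm n m r d ν = irrNormalization n m * shiftTerm n m d ν r := by
  rw [translationTerm, shiftTerm, Finset.mul_sum, Finset.mul_sum]
  refine Finset.sum_congr rfl fun μ hμ => ?_
  rw [Finset.mem_Icc] at hμ
  have hm' := abs_le.1 hm
  rw [regularSolid_eq ν μ (abs_le.2 hμ), irregularSolid_eq (n + ν) (m - μ)
    (by rw [abs_le]; push_cast; omega) r hr,
    ← translationCoeff_normalization n m hm ν μ (abs_le.2 hμ), shiftCoeff]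
  push_cast
  ring

/-- The translation expansion of the irregular solid harmonics. -/
theorem hasSum_translationTerm (n : ℕ) (m : ℤ) (r d : Space3) (hm : |m| ≤ (n : ℤ))
    (hd : ‖d‖ / ‖r‖ < 1) (hr : r ≠ 0) :
    HasSum (fun ν : ℕ => translationTerm n m r d ν) (irregularSolid n m (r + d)) := by
  have hrd : r + d ≠ 0 := by
    intro h
    have hn : ‖r‖ ≠ 0 := by simpa using hr
    rw [eq_neg_of_add_eq_zero_left h, norm_neg, div_self (by rwa [eq_neg_of_add_eq_zero_left h, norm_neg] at hn)] at hd
    exact lt_irrefl _ hd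
  simp only [translationTerm_eq n m hm r d hr]
  rw [irregularSolid_eq n m hm _ hrd]
  exact (hasSum_shiftTerm n m hm r d hr hd).mul_left _

/-! ### Truncation error -/

theorem irrNormalization_le (n : ℕ) (m : ℤ) : irrNormalization n m ≤ 2 * n + 1 := by
  rw [irrNormalization]
  have h1 : (1 : ℝ) ≤ factProd n m := by
    unfold factProd
    exact_mod_cast Nat.one_le_iff_ne_zero.2 (mul_ne_zero (Nat.factorial_ne_zero _) (Nat.factorial_ne_zero _))
  have h2 : (1 : ℝ) ≤ 4 * Real.pi := by linarith [Real.pi_gt_three]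
  refine Real.sqrt_le_iff.2 ⟨by positivity, ?_⟩
  calc (2 * n + 1 : ℝ) / (4 * Real.pi) / factProd n m ≤ 2 * n + 1 :=
        (div_le_self (by positivity) h1).trans (div_le_self (by positivity) h2)
    _ ≤ (2 * n + 1 : ℝ) ^ 2 := by nlinarith [Nat.cast_nonneg (α := ℝ) n]

theorem norm_translationTerm_le (n : ℕ) (m : ℤ) (hm : |m| ≤ (n : ℤ)) (r d : Space3) (hr : r ≠ 0)
    (ν : ℕ) : ‖translationTerm n m r d ν‖ ≤
      (2 * n + 1) * 2 ^ n * ((n + ν : ℝ) ^ n * (‖d‖ / ‖r‖) ^ ν) / ‖r‖ ^ (n + 1) := by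
  have hn : 0 < ‖r‖ := by simpa using hr
  rw [translationTerm_eq n m hm r d hr, norm_mul, Complex.norm_real,
    Real.norm_of_nonneg (show 0 ≤ irrNormalization n m from Real.sqrt_nonneg _)]
  calc _ ≤ (2 * n + 1) * ((2 * n + 2 * ν : ℝ) ^ n * ‖d‖ ^ ν / ‖r‖ ^ (n + ν + 1)) :=
        mul_le_mul (irrNormalization_le n m) (norm_shiftTerm_le n m hm r d hr ν) (norm_nonneg _)
          (by positivity)
    _ = _ := by
        rw [← mul_add, mul_pow, div_pow, show n + ν + 1 = ν + (n + 1) by ring, pow_add ‖r‖]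
        field_simp

theorem pow_le_factorial_mul_choose (n k : ℕ) : (k : ℝ) ^ n ≤ n.factorial * (k + n).choose n := by
  have h : k ^ n ≤ n.factorial * (k + n).choose n := by
    rw [← Nat.descFactorial_eq_factorial_mul_choose]
    refine le_trans ?_ (Nat.pow_sub_le_descFactorial (k + n) n)
    exact Nat.pow_le_pow_left (by omega) n
  exact_mod_cast h

/-- Split `(a + k)^n ≤ 2^n (a^n + k^n)` and dominate `k^n` by `n! (k+n choose n)`, whose generating
series is `(1 - ρ)^(-n-1)`. -/
theorem tsum_add_pow_mul_geometric_le (n : ℕ) {a ρ : ℝ} (ha : 0 ≤ a) (h0 : 0 ≤ ρ) (h1 : ρ < 1) :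
    Summable (fun k : ℕ => (a + k) ^ n * ρ ^ k) ∧
    ∑' k : ℕ, (a + k) ^ n * ρ ^ k ≤
      2 ^ n * (a ^ n + n.factorial * (1 / (1 - ρ)) ^ n) / (1 - ρ) := by
  have hρ : ‖ρ‖ < 1 := by rwa [Real.norm_of_nonneg h0]
  have hg := (hasSum_geometric_of_lt_one h0 h1).mul_left (a ^ n)
  have hc := (hasSum_choose_mul_geometric_of_norm_lt_one n hρ).mul_left (n.factorial : ℝ)
  have hs := (hg.add hc).mul_left (2 ^ n)
  have hle (k : ℕ) : (a + k) ^ n * ρ ^ k ≤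
      2 ^ n * (a ^ n * ρ ^ k + n.factorial * ((k + n).choose n * ρ ^ k)) := by
    have h2 : (a + k) ^ n ≤ 2 ^ n * (a ^ n + (k : ℝ) ^ n) := by
      refine (add_pow_le ha (by positivity) n).trans ?_
      gcongr
      · norm_num
      · omega
    calc _ ≤ 2 ^ n * (a ^ n + n.factorial * (k + n).choose n) * ρ ^ k := by
          gcongr
          exact h2.trans (by gcongr; exact pow_le_factorial_mul_choose n k)
      _ = _ := by ring
  have hsum : Summable (fun k : ℕ => (a + k) ^ n * ρ ^ k) :=
    Summable.of_nonneg_of_le (fun k => by positivity) hle hs.summable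
  refine ⟨hsum, (hsum.tsum_le_tsum hle hs.summable).trans (le_of_eq ?_)⟩
  have : 1 - ρ ≠ 0 := by linarith
  rw [hs.tsum_eq, pow_succ, one_div_pow]
  field_simp

theorem truncationError_le (n : ℕ) (m : ℤ) (hm : |m| ≤ (n : ℤ)) (r d : Space3) (hr : r ≠ 0)
    (hd : ‖d‖ / ‖r‖ < 1) (p : ℕ) :
    truncationError n m r d p ≤ (2 * n + 1) * 4 ^ n *
      ((n + p + 1 : ℝ) ^ n + n.factorial * (1 / (1 - ‖d‖ / ‖r‖)) ^ n) *
      ((‖d‖ / ‖r‖) ^ (p + 1) / ((1 - ‖d‖ / ‖r‖) * ‖r‖ ^ (n + 1))) := by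
  have hn : 0 < ‖r‖ := by simpa using hr
  set ρ := ‖d‖ / ‖r‖ with hρ
  have hρ0 : 0 ≤ ρ := by positivity
  obtain ⟨hs, hle⟩ := tsum_add_pow_mul_geometric_le n (a := n + p + 1) (by positivity) hρ0 hd
  have hterm (k : ℕ) : ‖translationTerm n m r d (p + 1 + k)‖ ≤
      ((2 * n + 1) * 2 ^ n * ρ ^ (p + 1) / ‖r‖ ^ (n + 1)) * ((n + p + 1 + k : ℝ) ^ n * ρ ^ k) := by
    refine (norm_translationTerm_le n m hm r d hr (p + 1 + k)).trans (le_of_eq ?_)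
    rw [← hρ]
    push_cast
    ring
  refine (tsum_of_norm_bounded (hs.hasSum.mul_left _) hterm).trans ?_
  refine (mul_le_mul_of_nonneg_left hle (by positivity)).trans (le_of_eq ?_)
  rw [show (4 : ℝ) = 2 * 2 by norm_num, mul_pow]
  have : 1 - ρ ≠ 0 := by linarith
  field_simp

/-- Write `p + 1 = N + x`. As `δ N ≥ 1`, `p + 1 ≤ 2N (1 + δx/2)`; then `y^n ≤ n! e^y`, and `e^(δx/2)
≤ (1 + δ)^x` because `log (1 + δ) ≥ δ/2` on `(0, 1]`. -/
theorem add_one_pow_le_threshold_pow (n : ℕ) {δ : ℝ} (h0 : 0 < δ) (h1 : δ ≤ 1) {p : ℕ}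
    (hp : truncationThreshold n δ ≤ p) :
    (p + 1 : ℝ) ^ n ≤ 2 ^ n * n.factorial * Real.exp 1 * truncationThreshold n δ ^ n *
      (1 + δ) ^ ((p : ℝ) + 1 - truncationThreshold n δ) := by
  set N := truncationThreshold n δ with hN
  have hN' : N = (n + 1) / δ := hN
  have hNpos : 0 < N := by rw [hN']; positivity
  have hδN : 1 ≤ δ * N := by
    rw [hN']; field_simp; linarith [Nat.cast_nonneg (α := ℝ) n]
  set x := (p : ℝ) + 1 - N with hx
  have hx0 : 0 ≤ x := by rw [hx]; linarith
  have hy : (p + 1 : ℝ) ≤ N * (2 * (1 + δ * x / 2)) := by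
    have : x ≤ δ * N * x := by nlinarith
    have : (p + 1 : ℝ) = N + x := by rw [hx]; ring
    nlinarith
  have hlog : δ / 2 ≤ Real.log (1 + δ) := by
    refine le_trans ?_ (Real.le_log_one_add_of_nonneg h0.le)
    rw [div_le_div_iff₀ (by norm_num) (by linarith)]
    nlinarith
  have hexp : Real.exp (δ * x / 2) ≤ (1 + δ) ^ x := by
    rw [Real.rpow_def_of_pos (by linarith)]
    exact Real.exp_le_exp.2 (by nlinarith)
  have hpow : (1 + δ * x / 2) ^ n ≤ n.factorial * (Real.exp 1 * (1 + δ) ^ x) := by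
    have := Real.pow_div_factorial_le_exp (x := 1 + δ * x / 2) (by positivity) n
    rw [div_le_iff₀ (by positivity), Real.exp_add, mul_comm _ (n.factorial : ℝ)] at this
    exact this.trans (by gcongr)
  calc (p + 1 : ℝ) ^ n ≤ (N * (2 * (1 + δ * x / 2))) ^ n := by gcongr
    _ = 2 ^ n * N ^ n * (1 + δ * x / 2) ^ n := by rw [mul_pow, mul_pow]; ring
    _ ≤ 2 ^ n * N ^ n * (n.factorial * (Real.exp 1 * (1 + δ) ^ x)) := by gcongr
    _ = _ := by ring

/-- Once `1 / (1 - ρ)` is at most linear in `p`, both parts of the tail bound are of order `(p +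
1)^n`. The parameter `D` lets one argument serve both error bounds. -/
theorem truncationError_le_of_inv_le (n : ℕ) {D : ℝ} (hD : 0 ≤ D) (m : ℤ) (hm : |m| ≤ (n : ℤ))
    (r d : Space3) (hr : r ≠ 0) (hd : ‖d‖ / ‖r‖ < 1) {δ : ℝ} (h0 : 0 < δ) (h1 : δ ≤ 1) {p : ℕ}
    (hp : truncationThreshold n δ ≤ p) (hinv : 1 / (1 - ‖d‖ / ‖r‖) ≤ D * (p + 1)) :
    truncationError n m r d p ≤ ((2 * n + 1) * 4 ^ n * (2 ^ n + n.factorial * D ^ n) *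
      (2 ^ n * n.factorial * Real.exp 1)) * truncationThreshold n δ ^ n *
      ((1 + δ) ^ ((p : ℝ) + 1 - truncationThreshold n δ) * (‖d‖ / ‖r‖) ^ (p + 1) /
        ((1 - ‖d‖ / ‖r‖) * ‖r‖ ^ (n + 1))) := by
  have hn : 0 < ‖r‖ := by simpa using hr
  have hN : (n + 1 : ℝ) ≤ truncationThreshold n δ := by
    rw [truncationThreshold, le_div_iff₀ h0]
    nlinarith [Nat.cast_nonneg (α := ℝ) n]
  have h1ρ : 0 < 1 - ‖d‖ / ‖r‖ := by linarith
  have hA : (n + p + 1 : ℝ) ^ n + n.factorial * (1 / (1 - ‖d‖ / ‖r‖)) ^ n ≤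
      (2 ^ n + n.factorial * D ^ n) * (p + 1 : ℝ) ^ n := by
    have e1 : (n + p + 1 : ℝ) ^ n ≤ (2 * (p + 1)) ^ n := by gcongr; linarith
    have e2 : (1 / (1 - ‖d‖ / ‖r‖)) ^ n ≤ (D * (p + 1)) ^ n := by gcongr
    rw [mul_pow] at e1 e2
    have e3 := mul_le_mul_of_nonneg_left e2 (Nat.cast_nonneg (α := ℝ) n.factorial)
    linarith
  refine (truncationError_le n m hm r d hr hd p).trans ?_
  calc _ ≤ (2 * n + 1) * 4 ^ n * ((2 ^ n + n.factorial * D ^ n) *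
        (2 ^ n * n.factorial * Real.exp 1 * truncationThreshold n δ ^ n *
          (1 + δ) ^ ((p : ℝ) + 1 - truncationThreshold n δ))) *
        ((‖d‖ / ‖r‖) ^ (p + 1) / ((1 - ‖d‖ / ‖r‖) * ‖r‖ ^ (n + 1))) := by
        gcongr
        exact hA.trans (by gcongr; exact add_one_pow_le_threshold_pow n h0 h1 hp)
    _ = _ := by ring

theorem exists_monic_truncationBound (n : ℕ) {D : ℝ} (hD : 0 ≤ D) :
    ∃ q : ℝ[X], q.Monic ∧ q.natDegree = 2 * n + 2 ∧
      ∀ (δ : ℝ) (m : ℤ) (r d : Space3), 0 < δ → δ ≤ 1 → |m| ≤ (n : ℤ) → r ≠ 0 → d ≠ 0 →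
        ‖d‖ / ‖r‖ < 1 → ∀ p : ℕ, truncationThreshold n δ ≤ (p : ℝ) →
          1 / (1 - ‖d‖ / ‖r‖) ≤ D * (p + 1) →
          truncationError n m r d p < truncationBound n q δ (‖d‖ / ‖r‖) ‖r‖ p := by
  set B : ℝ := (2 * n + 1) * 4 ^ n * (2 ^ n + n.factorial * D ^ n) *
      (2 ^ n * n.factorial * Real.exp 1) with hB
  have hB0 : 0 ≤ B := by positivity
  set K : ℝ := B ^ 2 * (4 * Real.pi * (2 * n).factorial) / 3 with hK
  have hK0 : 0 ≤ K := by positivity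
  -- `K` makes the second term alone match the bound `B N^n`; the leading term makes the inequality
  -- strict.
  refine ⟨X ^ (2 * n + 2) + C K * X ^ (2 * n), by monicity!, by compute_degree!, ?_⟩
  intro δ m r d h0 h1 hm hr hd0 hd p hp hinv
  have hn : 0 < ‖r‖ := by simpa using hr
  have hdn : 0 < ‖d‖ := by simpa using hd0
  have hN : 0 < truncationThreshold n δ := by unfold truncationThreshold; positivity
  have h1ρ : 0 < 1 - ‖d‖ / ‖r‖ := by linarith
  refine (truncationError_le_of_inv_le n hD m hm r d hr hd h0 h1 hp hinv).trans_lt ?_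
  rw [truncationBound, ← hB]
  refine mul_lt_mul_of_pos_right ?_ (by positivity)
  apply Real.lt_sqrt_of_sq_lt
  rw [lt_div_iff₀ (by positivity)]
  simp only [eval_add, eval_mul, eval_pow, eval_X, eval_C]
  set N := truncationThreshold n δ
  have e1 : (B * N ^ n) ^ 2 * (4 * Real.pi * (2 * n).factorial) = 3 * (K * N ^ (2 * n)) := by
    rw [hK]; ring
  have e2 : N ^ (2 * n) ≤ (2 * N) ^ (2 * n) := by gcongr; linarith
  have e3 := mul_le_mul_of_nonneg_left e2 hK0
  have e4 : 0 < (2 * N) ^ (2 * n + 2) := by positivity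
  rw [e1]
  linarith

end

theorem mainTheorem3 (n : ℕ) :
    -- the expansion
    (∀ (m : ℤ) (r dr : Space3), |m| ≤ (n : ℤ) → ‖dr‖ / ‖r‖ < 1 → r ≠ 0 →
      HasSum (fun ν : ℕ => translationTerm n m r dr ν) (irregularSolid n m (r + dr))) ∧
    -- the error bound for `(1 + δ) ρ < 1`, with `q` depending only on `n`
    (∃ q : Polynomial ℝ, q.Monic ∧ q.natDegree = 2 * n + 2 ∧
      ∀ (δ : ℝ) (m : ℤ) (r dr : Space3), 0 < δ → δ ≤ 1 → |m| ≤ (n : ℤ) → r ≠ 0 → dr ≠ 0 →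
        (1 + δ) * (‖dr‖ / ‖r‖) < 1 →
        ∀ p : ℕ, truncationThreshold n δ ≤ (p : ℝ) →
          truncationError n m r dr p < truncationBound n q δ (‖dr‖ / ‖r‖) ‖r‖ p) ∧
    -- the error bound for all `ρ < 1`, with `q` depending only on `n`, `δ` and an upper bound of `ρ`
    (∀ (δ ρ₀ : ℝ), 0 < δ → δ ≤ 1 → ρ₀ < 1 →
      ∃ q : Polynomial ℝ, q.Monic ∧ q.natDegree = 2 * n + 2 ∧
        ∀ (m : ℤ) (r dr : Space3), |m| ≤ (n : ℤ) → r ≠ 0 → dr ≠ 0 → ‖dr‖ / ‖r‖ ≤ ρ₀ →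
          ∀ p : ℕ, truncationThreshold n δ ≤ (p : ℝ) →
            truncationError n m r dr p < truncationBound n q δ (‖dr‖ / ‖r‖) ‖r‖ p) := by

  refine ⟨fun m r dr hm hd hr => hasSum_translationTerm n m r dr hm hd hr, ?_, ?_⟩
  -- From `(1 + δ) ρ < 1` and `δ ≤ 1` one gets `1 - ρ ≥ δ/2`, while `p ≥ N` gives `p δ ≥ 1`; hence
  -- `1 / (1 - ρ) ≤ 2p`.
  · obtain ⟨q, hq, hdeg, h⟩ := exists_monic_truncationBound n (D := 2) (by norm_num)
    refine ⟨q, hq, hdeg, fun δ m r dr h0 h1 hm hr hdr hδ p hp => ?_⟩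
    have hρ0 : 0 ≤ ‖dr‖ / ‖r‖ := by positivity
    have hρ : ‖dr‖ / ‖r‖ < 1 := by nlinarith
    refine h δ m r dr h0 h1 hm hr hdr hρ p hp ?_
    have hpδ : 1 ≤ p * δ := by
      rw [truncationThreshold, div_le_iff₀ h0] at hp
      linarith [Nat.cast_nonneg (α := ℝ) n]
    rw [div_le_iff₀ (by linarith)]
    generalize ‖dr‖ / ‖r‖ = ρ at *
    have h2 : δ ≤ (1 + δ) * (1 - ρ) := by linarith
    have h3 : δ ≤ 2 * (1 - ρ) := by nlinarith
    have h4 : (p : ℝ) * δ ≤ p * (2 * (1 - ρ)) := by gcongr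
    nlinarith
  · intro δ ρ₀ h0 h1 hρ₀
    obtain ⟨q, hq, hdeg, h⟩ := exists_monic_truncationBound n (D := 1 / (1 - ρ₀))
      (one_div_nonneg.2 (by linarith))
    refine ⟨q, hq, hdeg, fun m r dr hm hr hdr hρ p hp => ?_⟩
    refine h δ m r dr h0 h1 hm hr hdr (hρ.trans_lt hρ₀) p hp ?_
    have h2 : 1 / (1 - ‖dr‖ / ‖r‖) ≤ 1 / (1 - ρ₀) :=
      one_div_le_one_div_of_le (by linarith) (by linarith)
    exact h2.trans (le_mul_of_one_le_right (one_div_nonneg.2 (by linarith))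
      (by linarith [Nat.cast_nonneg (α := ℝ) p]))
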